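/- Let $\rho_{A_1}$ be a one-qubit state and let $\rho_{A_2A_3}$, $\rho_{A_4A_5}$ be two-qubit states (states are positive semidefinite matrices of trace one, pure or mixed). An $n$-qubit state $\rho$ is called 2-UDA if no other $n$-qubit state has the same reduced states as $\rho$ on all pairs of qubits. Two $n$-qubit states are LU equivalent if $\rho=(U_1\otimes\cdots\otimes U_n)\,\sigma\,(U_1\otimes\cdots\otimes U_n)^\dagger$ for single-qubit unitaries $U_1,\dots,U_n$. A two-qubit state is said to be of the form $D\oplus 0$ if it has rank two and, in the ordered basis $|00\rangle,|01\rangle,|10\rangle,|11\rangle$, it equals $$D\oplus 0=\begin{bmatrix} q_1&y&z&0\\ y^*&q_2&x&0\\ z^*&x^*&q_3&0\\ 0&0&0&0\end{bmatrix},\qquad q_1,q_2,q_3\in\mathbb R,\quad x,y,z\in\mathbb C,\quad q_1q_2q_3>0 .$$ Then the five-qubit state $\rho=\rho_{A_1}\otimes\rho_{A_2A_3}\otimes\rho_{A_4A_5}$ is 2-UDA if and only if at least one of the following conditions holds. (i) One of $\rho_{A_2A_3}$, $\rho_{A_4A_5}$ is pure and, writing $\rho_{A_{m_1}A_{m_2}}$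 for the other one, the three-qubit state $\rho_{A_1}\otimes\rho_{A_{m_1}A_{m_2}}$ satisfies at least one of: (a) at least one of its three 1-qubit marginals is pure; (b) $\rho_{A_{m_1}A_{m_2}}$ is pure; (c) $\operatorname{rank}\rho_{A_1}=\operatorname{rank}\rho_{A_{m_1}A_{m_2}}=2$ and $\rho_{A_{m_1}A_{m_2}}$ is LU equivalent to a state of the form $D\oplus 0$. (ii) $\rho_{A_1}$ is pure, at least one of the marginals $\rho_{A_2},\rho_{A_3}$ is pure, and at least one of the marginals $\rho_{A_4},\rho_{A_5}$ is pure. (iii) $\rho$ is LU equivalent to $|\psi\rangle\langle\psi|_{A_1}\otimes|\phi\rangle\langle\phi|_{A_{n_1}}\otimes\tau_{A_{n_2}}\otimes(D\oplus 0)_{A_{m_1}A_{m_2}}$, where $|\psi\rangle,|\phi\rangle$ are one-qubit unit vectors, $\tau$ is a one-qubit state of rank two, $(D\oplus 0)$ is a state of the form above, and either $\{n_1,n_2\}=\{2,3\}$, $(m_1,m_2)=(4,5)$, or $\{n_1,n_2\}=\{4,5\}$, $(m_1,m_2)=(2,3)$. (iv) $\rho$ is LU equivalent to $|\psi\rangle\langle\psi|_{A_1}\otimes(H\oplus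 0)_{A_2A_3}\otimes(D\oplus 0)_{A_4A_5}$, where $|\psi\rangle$ is a one-qubit unit vector and $H\oplus 0$ and $D\oplus 0$ are both states of the form above. -/

import Mathlib

noncomputable section

namespace QubitUDA

open scoped ComplexOrder

/-- Operators on the Hilbert space of a family of qubits labelled by `ι`, written in the
computational basis `|x⟩`, `x : ι → Fin 2`. -/
abbrev QubitOp (ι : Type) : Type := Matrix (ι → Fin 2) (ι → Fin 2) ℂ

/-- A (pure or mixed) state: a positive semidefinite matrix of trace one. -/
def IsState {X : Type} [Fintype X] (ρ : Matrix X X ℂ) : Prop :=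
  ρ.PosSemidef ∧ ρ.trace = 1

/-- A pure state: `ρ = |ψ⟩⟨ψ|` for a unit vector `ψ`. -/
def IsPure {X : Type} [Fintype X] (ρ : Matrix X X ℂ) : Prop :=
  ∃ ψ : X → ℂ, star ψ ⬝ᵥ ψ = 1 ∧ ρ = Matrix.vecMulVec ψ (star ψ)

/-- The basis label that is `x` on the systems in `S` and `z` on the other systems. -/
def glue {ι : Type} [DecidableEq ι] (S : Finset ι)
    (x : {i // i ∈ S} → Fin 2) (z : {i // i ∉ S} → Fin 2) : ι → Fin 2 :=
  fun i => if h : i ∈ S then x ⟨i, h⟩ else z ⟨i, h⟩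

/-- The marginal (reduced state) on the systems in `S`: the partial trace over the systems
outside `S`. -/
def marginal {ι : Type} [Fintype ι] [DecidableEq ι] (ρ : QubitOp ι) (S : Finset ι) :
    QubitOp {i // i ∈ S} :=
  Matrix.of fun x y => ∑ z : {i // i ∉ S} → Fin 2, ρ (glue S x z) (glue S y z)

/-- `σ` is `k`-compatible with `ρ`: they have the same `k`-partite marginals. -/
def Compatible {ι : Type} [Fintype ι] [DecidableEq ι] (k : ℕ) (ρ σ : QubitOp ι) : Prop :=
  ∀ S : Finset ι, S.card = k → marginal σ S = marginal ρ S

/-- `ρ` is `k`-uniquely determined among all states: it is a state, and no other state is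
`k`-compatible with it. -/
def IsUDA {ι : Type} [Fintype ι] [DecidableEq ι] (k : ℕ) (ρ : QubitOp ι) : Prop :=
  IsState ρ ∧ ∀ σ : QubitOp ι, IsState σ → Compatible k ρ σ → σ = ρ

/-- The tensor product of an operator on `m` qubits and an operator on the next `n` qubits. -/
def tensor {m n : ℕ} (α : QubitOp (Fin m)) (β : QubitOp (Fin n)) : QubitOp (Fin (m + n)) :=
  Matrix.of fun x y =>
    α (fun i => x (Fin.castAdd n i)) (fun i => y (Fin.castAdd n i)) *
      β (fun j => x (Fin.natAdd m j)) (fun j => y (Fin.natAdd m j))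

/-- The three-qubit operator `ρ_{A₁} ⊗ ρ_{A₂A₃}`. -/
def product12 (α : QubitOp (Fin 1)) (β : QubitOp (Fin 2)) : QubitOp (Fin 3) :=
  tensor α β

/-- The five-qubit operator `ρ_{A₁} ⊗ ρ_{A₂A₃} ⊗ ρ_{A₄A₅}`; the system `Aⱼ` has the label
`j - 1` in `Fin 5`. -/
def product122 (α : QubitOp (Fin 1)) (β γ : QubitOp (Fin 2)) : QubitOp (Fin 5) :=
  tensor (tensor α β) γ

/-- The two-qubit operator `α ⊗ β`. -/
def product11 (α β : QubitOp (Fin 1)) : QubitOp (Fin 2) :=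
  tensor α β

/-- The product operator `U₁ ⊗ ⋯ ⊗ Uₙ` of single-qubit operators. -/
def localOp {n : ℕ} (U : Fin n → Matrix (Fin 2) (Fin 2) ℂ) : QubitOp (Fin n) :=
  Matrix.of fun x y => ∏ i, U i (x i) (y i)

/-- Local unitary (LU) equivalence:
`ρ = (U₁ ⊗ ⋯ ⊗ Uₙ) σ (U₁ ⊗ ⋯ ⊗ Uₙ)†` with each `Uᵢ` unitary. -/
def LUEquiv {n : ℕ} (ρ σ : QubitOp (Fin n)) : Prop :=
  ∃ U : Fin n → Matrix (Fin 2) (Fin 2) ℂ,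
    (∀ i, U i ∈ Matrix.unitaryGroup (Fin 2) ℂ) ∧
      ρ = localOp U * σ * (localOp U).conjTranspose

/-- The two-qubit matrix `D ⊕ 0`, with rows and columns in the order `00, 01, 10, 11`
(`finProdFinEquiv (a, b)` is the number `2 a + b`). -/
def blockForm (q₁ q₂ q₃ : ℝ) (x y z : ℂ) : QubitOp (Fin 2) :=
  Matrix.submatrix
    (!![(q₁ : ℂ), y, z, 0;
        star y, (q₂ : ℂ), x, 0;
        star z, star x, (q₃ : ℂ), 0;
        0, 0, 0, 0] : Matrix (Fin (2 * 2)) (Fin (2 * 2)) ℂ)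
    (fun s => finProdFinEquiv (s 0, s 1)) (fun s => finProdFinEquiv (s 0, s 1))

/-- A rank-two two-qubit state of the form `D ⊕ 0` with `q₁ q₂ q₃ > 0`. -/
def IsBlockState (ω : QubitOp (Fin 2)) : Prop :=
  IsState ω ∧ ω.rank = 2 ∧
    ∃ (q₁ q₂ q₃ : ℝ) (x y z : ℂ), 0 < q₁ * q₂ * q₃ ∧ ω = blockForm q₁ q₂ q₃ x y z

/-- The conditions on a three-qubit state `ρ_{A} ⊗ ρ_{BC}`: some 1-marginal is pure, or
`ρ_{BC}` is pure, or both factors have rank two and `ρ_{BC}` is LU equivalent to a state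
`D ⊕ 0` with `q₁ q₂ q₃ > 0`. -/
def ThreeQubitConditions (ρA : QubitOp (Fin 1)) (ρBC : QubitOp (Fin 2)) : Prop :=
  (∃ i : Fin 3, IsPure (marginal (product12 ρA ρBC) {i})) ∨
  IsPure ρBC ∨
  (ρA.rank = 2 ∧ ρBC.rank = 2 ∧ ∃ ω, IsBlockState ω ∧ LUEquiv ρBC ω)

end QubitUDA

end

noncomputable section

namespace QubitUDA

open scoped ComplexOrder
open Matrix

/-! ### Spectral tools and trace functionals for Hermitian and positive semidefinite matrices. -/

section MatrixLemmas

variable {X : Type} [Fintype X] [DecidableEq X]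

/-! Call the number of tensor slots in which a product operator differs from the identity its
weight. `DeterminedBelow k ρ` says that an operator of the form `ρ * M * ρ` is zero as soon as it is
trace-orthogonal to all product operators of weight less than `k`. For a state `ρ`, let `d ρ` be the
least `d` with `DeterminedBelow (d + 1) ρ`; on `n` qubits it is at most `n`.

Being `k`-UDA forces `d ρ ≤ k`: a nonzero Hermitian `ρ * M * ρ` with vanishing `k`-marginals could
be added to `ρ` with a small coefficient (`IsUDA.determinedBelow`). Conversely, if `ρ` is a product
of three states on at most `k` qubits each, any compatible state has the same factor marginals,
hence is supported inside the support of `ρ`, and `d ρ ≤ k` then forces equality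
(`isUDA_of_determinedBelow`).

The invariant is additive on tensor products (`DeterminedBelow.tensor`,
`not_determinedBelow_tensor`), so the question becomes whether the three values of `d` sum to at
most 2. One has `d = 0` exactly for pure states. For two qubits, `d ≤ 1` holds exactly when the
state is pure, has a pure one-qubit marginal, or is LU equivalent to a block state `D ⊕ 0`
(`determinedBelow_two_iff`). There a dimension count bounds the rank by two, and the kernel, being
at least two-dimensional, contains a product vector that local unitaries move to `|11⟩`. Listing the
triples with sum at most 2 gives the theorem. -/

theorem exists_unitary_diagonalization {A : Matrix X X ℂ} (hA : A.IsHermitian) :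
    ∃ (U : Matrix X X ℂ) (d : X → ℝ), U * Uᴴ = 1 ∧ Uᴴ * U = 1 ∧
      A = U * diagonal (fun i => (d i : ℂ)) * Uᴴ ∧ A.rank = Fintype.card {i // d i ≠ 0} := by
  refine ⟨hA.eigenvectorUnitary, hA.eigenvalues, ?_, ?_, ?_, hA.rank_eq_card_non_zero_eigs⟩
  · exact Unitary.coe_mul_star_self _
  · exact Unitary.coe_star_mul_self _
  · have := hA.spectral_theorem
    rw [Unitary.conjStarAlgAut_apply] at this
    exact this

/-- Inverts the nonzero eigenvalues, so that `A * T` is the projection onto the support of `A`. -/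
theorem exists_pseudoinverse {A : Matrix X X ℂ} (hA : A.IsHermitian) :
    ∃ T : Matrix X X ℂ, T.IsHermitian ∧ T * A = A * T ∧ A * T * A = A := by
  obtain ⟨U, d, h1, h2, h3, -⟩ := exists_unitary_diagonalization hA
  have key : ∀ D E : Matrix X X ℂ, U * D * Uᴴ * (U * E * Uᴴ) = U * (D * E) * Uᴴ := by
    intro D E
    calc _ = U * D * (Uᴴ * U) * E * Uᴴ := by noncomm_ring
      _ = _ := by rw [h2]; noncomm_ring
  -- The convention `0⁻¹ = 0` leaves the kernel of `A` in the kernel of `T`.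
  refine ⟨U * diagonal (fun i => ((d i)⁻¹ : ℂ)) * Uᴴ, ?_, ?_, ?_⟩
  · refine Matrix.isHermitian_mul_mul_conjTranspose U ?_
    simp [Matrix.IsHermitian, diagonal_conjTranspose, Pi.star_def]
  · rw [h3, key, key]
    simp only [diagonal_mul_diagonal, mul_comm]
  · rw [h3, key, key]
    simp only [diagonal_mul_diagonal]
    congr 3
    funext i
    by_cases h : (d i : ℂ) = 0 <;> simp [h]

theorem exists_eq_conjTranspose_mul_self {A : Matrix X X ℂ} (hA : A.PosSemidef) :
    ∃ B : Matrix X X ℂ, A = Bᴴ * B := by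
  open scoped MatrixOrder in
  obtain ⟨B, hB⟩ := CStarAlgebra.nonneg_iff_eq_star_mul_self.mp hA.nonneg
  exact ⟨B, hB⟩

theorem exists_posSemidef_one_add_smul {N : Matrix X X ℂ} (hN : N.IsHermitian) :
    ∃ ε : ℝ, 0 < ε ∧ (1 + (ε : ℂ) • N).PosSemidef := by
  obtain ⟨U, d, h1, h2, h3, -⟩ := exists_unitary_diagonalization hN
  have hs : 0 ≤ ∑ i, |d i| := Finset.sum_nonneg fun i _ => abs_nonneg _
  -- This `ε` makes every eigenvalue of `ε • N` at least `-1`; the summand 1 keeps the denominator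
  -- positive.
  refine ⟨(1 + ∑ i, |d i|)⁻¹, by positivity, ?_⟩
  set ε : ℝ := (1 + ∑ i, |d i|)⁻¹ with hε
  have : 1 + (ε : ℂ) • N = U * diagonal (fun i => ((1 + ε * d i : ℝ) : ℂ)) * Uᴴ := by
    have h4 : diagonal (fun i => ((1 + ε * d i : ℝ) : ℂ))
        = 1 + (ε : ℂ) • diagonal (fun i => (d i : ℂ)) := by
      rw [← diagonal_one, ← diagonal_smul, diagonal_add]
      congr 1; funext i; simp
    rw [h4, Matrix.mul_add, Matrix.add_mul, Matrix.mul_one, h1, h3]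
    simp
  rw [this]
  refine PosSemidef.mul_mul_conjTranspose_same (PosSemidef.diagonal fun i => ?_) U
  have h5 : |d i| ≤ ∑ i, |d i| := Finset.single_le_sum (f := fun i => |d i|)
    (fun i _ => abs_nonneg _) (Finset.mem_univ i)
  have h6 : -1 ≤ ε * d i := by
    have : |ε * d i| ≤ 1 := by
      rw [abs_mul, abs_of_pos (by positivity), hε, inv_mul_le_one₀ (by positivity)]
      linarith
    exact (abs_le.mp this).1
  have h7 : (0 : ℝ) ≤ 1 + ε * d i := by linarith
  simpa using (Complex.zero_le_real.mpr h7)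

/-- With `A = Bᴴ * B`, the trace is the squared Hilbert–Schmidt norm of `B * P`. -/
theorem mul_eq_zero_of_trace_eq_zero {A P : Matrix X X ℂ} (hA : A.PosSemidef)
    (hP : P.IsHermitian) (hPP : P * P = P) (h : (A * P).trace = 0) : A * P = 0 ∧ P * A = 0 := by
  obtain ⟨B, rfl⟩ := exists_eq_conjTranspose_mul_self hA
  have h1 : ((B * P)ᴴ * (B * P)).trace = 0 := by
    rw [conjTranspose_mul, hP.eq, Matrix.mul_assoc, trace_mul_comm, ← h, Matrix.mul_assoc,
      Matrix.mul_assoc, Matrix.mul_assoc, hPP]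
  have h2 : B * P = 0 := trace_conjTranspose_mul_self_eq_zero_iff.mp h1
  refine ⟨by rw [Matrix.mul_assoc, h2, Matrix.mul_zero], ?_⟩
  have : P * Bᴴ = 0 := by rw [← hP.eq, ← conjTranspose_mul, h2, conjTranspose_zero]
  rw [← Matrix.mul_assoc, this, Matrix.zero_mul]

/-- The linear functional `Y ↦ Tr (H Y)`. -/
def traceFunctional (H : Matrix X X ℂ) : Matrix X X ℂ →ₗ[ℂ] ℂ :=
  traceLinearMap X ℂ ℂ ∘ₗ LinearMap.mulLeft ℂ H

@[simp] theorem traceFunctional_apply (H Y : Matrix X X ℂ) :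
    traceFunctional H Y = (H * Y).trace := rfl

theorem exists_eq_traceFunctional (f : Matrix X X ℂ →ₗ[ℂ] ℂ) : ∃ H, f = traceFunctional H := by
  refine ⟨of fun i j => f (single j i 1), ?_⟩
  refine ext_linearMap _ fun i j => ?_
  ext
  simp [trace_mul_single]

theorem traceFunctional_eq_zero {H : Matrix X X ℂ} (h : ∀ Y, (H * Y).trace = 0) : H = 0 := by
  ext i j
  simpa [trace_mul_single] using h (single j i 1)

end MatrixLemmas

/-! ### Product operators and tensor products. -/

section Local

variable {n m k : ℕ}

theorem localOp_apply (U : Fin n → Matrix (Fin 2) (Fin 2) ℂ) (x y : Fin n → Fin 2) :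
    localOp U x y = ∏ i, U i (x i) (y i) := rfl

theorem localOp_mul (U V : Fin n → Matrix (Fin 2) (Fin 2) ℂ) :
    localOp U * localOp V = localOp (fun i => U i * V i) := by
  ext x y
  simp only [mul_apply, localOp_apply, ← Finset.prod_mul_distrib]
  rw [Finset.prod_univ_sum, Fintype.piFinset_univ]

theorem localOp_one : localOp (fun _ : Fin n => (1 : Matrix (Fin 2) (Fin 2) ℂ)) = 1 := by
  ext x y
  simp only [localOp_apply, one_apply, Finset.prod_ite_zero, funext_iff]
  simp

theorem localOp_conjTranspose (U : Fin n → Matrix (Fin 2) (Fin 2) ℂ) :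
    (localOp U)ᴴ = localOp (fun i => (U i)ᴴ) := by
  ext x y
  simp [localOp_apply]

theorem single_eq_localOp (x y : Fin n → Fin 2) :
    single x y (1 : ℂ) = localOp (fun i => single (x i) (y i) 1) := by
  ext a b
  simp only [localOp_apply, single_apply, Finset.prod_ite_zero, Finset.mem_univ, true_imp_iff,
    Finset.prod_const_one]
  congr 1
  simp only [funext_iff, forall_and]

/-- Matrix units are product operators, so product operators span. -/
theorem linearMap_eq_zero_of_localOp {M : Type*} [AddCommMonoid M] [Module ℂ M]
    {f : QubitOp (Fin n) →ₗ[ℂ] M} (h : ∀ U, f (localOp U) = 0) : f = 0 := by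
  refine ext_linearMap _ fun i j => ?_
  ext
  simp [single_eq_localOp, h]

theorem tensor_eq_kronecker (α : QubitOp (Fin m)) (β : QubitOp (Fin n)) :
    tensor α β = (kroneckerMap (· * ·) α β).submatrix (Fin.appendEquiv m n).symm
      (Fin.appendEquiv m n).symm := rfl

theorem tensor_mul (α α' : QubitOp (Fin m)) (β β' : QubitOp (Fin n)) :
    tensor α β * tensor α' β' = tensor (α * α') (β * β') := by
  simp only [tensor_eq_kronecker, submatrix_mul_equiv, mul_kronecker_mul]

theorem tensor_one : tensor (1 : QubitOp (Fin m)) (1 : QubitOp (Fin n)) = 1 := by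
  simp only [tensor_eq_kronecker, one_kronecker_one, submatrix_one_equiv]

theorem tensor_conjTranspose (α : QubitOp (Fin m)) (β : QubitOp (Fin n)) :
    (tensor α β)ᴴ = tensor αᴴ βᴴ := by
  simp only [tensor_eq_kronecker, conjTranspose_submatrix, conjTranspose_kronecker]

theorem trace_tensor (α : QubitOp (Fin m)) (β : QubitOp (Fin n)) :
    (tensor α β).trace = α.trace * β.trace := by
  rw [← trace_kronecker, tensor_eq_kronecker]
  exact Equiv.sum_comp (Fin.appendEquiv m n).symm
    (fun i => (kroneckerMap (· * ·) α β) i i)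

theorem IsState.tensor {α : QubitOp (Fin m)} {β : QubitOp (Fin n)} (hα : IsState α)
    (hβ : IsState β) : IsState (tensor α β) :=
  ⟨(hα.1.kronecker hβ.1).submatrix (Fin.appendEquiv m n).symm, by rw [trace_tensor, hα.2, hβ.2, one_mul]⟩

/-- The tensor product as a bilinear map. -/
def tensorBilin (m n : ℕ) :
    QubitOp (Fin m) →ₗ[ℂ] QubitOp (Fin n) →ₗ[ℂ] QubitOp (Fin (m + n)) :=
  LinearMap.mk₂ ℂ tensor
    (fun _ _ _ => by ext; simp [QubitUDA.tensor, add_mul])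
    (fun _ _ _ => by ext; simp [QubitUDA.tensor, mul_assoc])
    (fun _ _ _ => by ext; simp [QubitUDA.tensor, mul_add])
    (fun _ _ _ => by ext; simp [QubitUDA.tensor, mul_left_comm])

@[simp] theorem tensorBilin_apply (α : QubitOp (Fin m)) (β : QubitOp (Fin n)) :
    tensorBilin m n α β = tensor α β := rfl

theorem tensor_localOp (U : Fin m → Matrix (Fin 2) (Fin 2) ℂ)
    (V : Fin n → Matrix (Fin 2) (Fin 2) ℂ) :
    tensor (localOp U) (localOp V) = localOp (Fin.append U V) := by
  ext x y
  simp [QubitUDA.tensor, localOp_apply, Fin.prod_univ_add]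

theorem localOp_eq_tensor (X : Fin (m + n) → Matrix (Fin 2) (Fin 2) ℂ) :
    localOp X = tensor (localOp fun i => X (Fin.castAdd n i)) (localOp fun j => X (Fin.natAdd m j)) := by
  rw [tensor_localOp, Fin.append_castAdd_natAdd]

end Local

/-! ### Weight of product operators and its relation to marginals. -/

section Weight

variable {n m k : ℕ}

open Classical in
/-- The number of systems on which a family of single-qubit operators is not the identity. -/
def weight (X : Fin n → Matrix (Fin 2) (Fin 2) ℂ) : ℕ :=
  ∑ i, if X i = 1 then 0 else 1

theorem weight_append (X : Fin m → Matrix (Fin 2) (Fin 2) ℂ)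
    (Y : Fin n → Matrix (Fin 2) (Fin 2) ℂ) : weight (Fin.append X Y) = weight X + weight Y := by
  simp [weight, Fin.sum_univ_add]

theorem weight_eq_add (X : Fin (m + n) → Matrix (Fin 2) (Fin 2) ℂ) :
    weight X = weight (fun i => X (Fin.castAdd n i)) + weight (fun j => X (Fin.natAdd m j)) := by
  rw [← weight_append, Fin.append_castAdd_natAdd]

@[simp] theorem weight_one : weight (fun _ : Fin n => (1 : Matrix (Fin 2) (Fin 2) ℂ)) = 0 := by
  simp [weight]

theorem weight_congr {X Y : Fin n → Matrix (Fin 2) (Fin 2) ℂ} (h : ∀ i, X i = 1 ↔ Y i = 1) :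
    weight X = weight Y := by
  simp [weight, h]

open Classical in
theorem weight_eq_card (X : Fin n → Matrix (Fin 2) (Fin 2) ℂ) :
    weight X = (Finset.univ.filter fun i => X i ≠ 1).card := by
  rw [Finset.card_filter, weight]
  exact Finset.sum_congr rfl fun i _ => by split_ifs <;> simp_all

theorem weight_le_card {X : Fin n → Matrix (Fin 2) (Fin 2) ℂ} {S : Finset (Fin n)}
    (h : ∀ i ∉ S, X i = 1) : weight X ≤ S.card := by
  classical
  rw [weight_eq_card]
  refine Finset.card_le_card fun i hi => ?_
  by_contra h1
  exact (Finset.mem_filter.mp hi).2 (h i h1)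

theorem weight_le (X : Fin n → Matrix (Fin 2) (Fin 2) ℂ) : weight X ≤ n := by
  simpa using weight_le_card (X := X) (S := Finset.univ) (by simp)

theorem exists_card_eq_of_weight_le {X : Fin n → Matrix (Fin 2) (Fin 2) ℂ} (h : weight X ≤ k)
    (hk : k ≤ n) : ∃ S : Finset (Fin n), S.card = k ∧ ∀ i ∉ S, X i = 1 := by
  classical
  rw [weight_eq_card] at h
  obtain ⟨S, hS, hc⟩ := Finset.exists_superset_card_eq h (by simpa using hk)
  refine ⟨S, hc, fun i hi => ?_⟩
  by_contra h2
  exact hi (hS (by simp [h2]))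

theorem trace_mul_localOp (H : QubitOp (Fin n)) (S : Finset (Fin n))
    {X : Fin n → Matrix (Fin 2) (Fin 2) ℂ} (hX : ∀ i ∉ S, X i = 1) :
    (H * localOp X).trace
      = ∑ a, ∑ b, marginal H S a b * ∏ i : {i // i ∈ S}, X i (b i) (a i) := by
  let e := Equiv.piEquivPiSubtypeProd (fun i => i ∈ S) (fun _ : Fin n => Fin 2)
  have he : ∀ a z, e.symm (a, z) = glue S a z := fun a z => rfl
  have hprod : ∀ a z b w, ∏ i, X i (glue S b w i) (glue S a z i)
      = (∏ i : {i // i ∈ S}, X i (b i) (a i)) * if w = z then 1 else 0 := by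
    intro a z b w
    rw [← Fintype.prod_subtype_mul_prod_subtype (fun i => i ∈ S)]
    congr 1
    · exact Finset.prod_congr (Finset.ext (by simp)) fun i _ => by simp [glue]
    · have : ∀ i : {i // i ∉ S}, X i (glue S b w i) (glue S a z i)
          = if w i = z i then 1 else 0 := by
        intro i
        simp [glue, hX i i.2, one_apply, i.2]
      simp only [this, Finset.prod_ite_zero, funext_iff]
      simp
  calc (H * localOp X).trace = ∑ x, ∑ y, H x y * ∏ i, X i (y i) (x i) := by
        simp [trace, mul_apply, localOp_apply]
    _ = ∑ p, ∑ q, H (e.symm p) (e.symm q) * ∏ i, X i (e.symm q i) (e.symm p i) := by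
        rw [← Equiv.sum_comp e.symm]
        exact Finset.sum_congr rfl fun p _ => by rw [← Equiv.sum_comp e.symm]
    _ = ∑ a, ∑ z, ∑ b, H (glue S a z) (glue S b z) * ∏ i : {i // i ∈ S}, X i (b i) (a i) := by
        simp [Fintype.sum_prod_type, he, hprod]
    _ = _ := by
        refine Finset.sum_congr rfl fun a _ => ?_
        rw [Finset.sum_comm]
        refine Finset.sum_congr rfl fun b _ => ?_
        rw [marginal, of_apply, Finset.sum_mul]

theorem marginal_apply_eq_trace (H : QubitOp (Fin n)) (S : Finset (Fin n))
    (a b : {i // i ∈ S} → Fin 2) :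
    marginal H S a b = (H * localOp fun i =>
      if h : i ∈ S then single (b ⟨i, h⟩) (a ⟨i, h⟩) 1 else 1).trace := by
  rw [trace_mul_localOp H S (fun i hi => by simp [hi])]
  have : ∀ a' b' : {i // i ∈ S} → Fin 2, ∏ i : {i // i ∈ S},
      (if h : (i : Fin n) ∈ S then single (b ⟨i, h⟩) (a ⟨i, h⟩) 1 else 1 :
        Matrix (Fin 2) (Fin 2) ℂ) (b' i) (a' i) = if b = b' ∧ a = a' then 1 else 0 := by
    intro a' b'
    rw [Finset.prod_congr rfl fun i _ => by rw [dif_pos i.2, single_apply]]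
    simp only [Finset.prod_ite_zero, Finset.mem_univ, true_imp_iff, Finset.prod_const_one,
      funext_iff, forall_and]
  simp only [this]
  simp [ite_and]

/-- A product operator of weight at most `k` is the identity off some `k`-set, and matrix units on a
`k`-set read off the entries of the marginal. The bound is written `< k + 1` to match
`DeterminedBelow (k + 1)`. -/
theorem compatible_iff {ρ σ : QubitOp (Fin n)} (hk : k ≤ n) :
    Compatible k ρ σ ↔ ∀ X : Fin n → Matrix (Fin 2) (Fin 2) ℂ, weight X < k + 1 →
      (σ * localOp X).trace = (ρ * localOp X).trace := by
  constructor
  · intro h X hX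
    obtain ⟨S, hS, hXS⟩ := exists_card_eq_of_weight_le (Nat.lt_succ_iff.mp hX) hk
    rw [trace_mul_localOp _ S hXS, trace_mul_localOp _ S hXS, h S hS]
  · intro h S hS
    ext a b
    rw [marginal_apply_eq_trace, marginal_apply_eq_trace]
    refine h _ (Nat.lt_succ_iff.mpr (hS ▸ weight_le_card fun i hi => by simp [hi]))

end Weight

/-! ### The determination property and its additivity under tensor products. -/

section Determined

variable {n m : ℕ}

/-- Every linear functional that only sees the compression to the support of `ρ`, and that
vanishes on the product operators of weight less than `k`, is zero. -/
def DeterminedBelow (k : ℕ) (ρ : QubitOp (Fin n)) : Prop :=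
  ∀ f : QubitOp (Fin n) →ₗ[ℂ] ℂ, (∀ Y, ρ * Y * ρ = 0 → f Y = 0) →
    (∀ X, weight X < k → f (localOp X) = 0) → f = 0

theorem DeterminedBelow.mono {ρ : QubitOp (Fin n)} {j k : ℕ} (h : DeterminedBelow j ρ)
    (hjk : j ≤ k) : DeterminedBelow k ρ :=
  fun f hf hX => h f hf fun X hw => hX X (hw.trans_le hjk)

theorem determinedBelow_of_lt (ρ : QubitOp (Fin n)) {k : ℕ} (hk : n < k) :
    DeterminedBelow k ρ :=
  fun _ _ hX => linearMap_eq_zero_of_localOp fun U => hX U ((weight_le U).trans_lt hk)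

/-- Such a functional does not distinguish `Y` from its compression to the support of `ρ`, which
allows its matrix `M` to be replaced by `ρ * (T * M * T) * ρ`. -/
theorem exists_compression {ρ : QubitOp (Fin n)} (hρ : ρ.IsHermitian)
    {f : QubitOp (Fin n) →ₗ[ℂ] ℂ} (hf : ∀ Y, ρ * Y * ρ = 0 → f Y = 0) :
    ∃ M, f = traceFunctional (ρ * M * ρ) := by
  obtain ⟨T, hT, hc, hi⟩ := exists_pseudoinverse hρ
  obtain ⟨M, rfl⟩ := exists_eq_traceFunctional f
  refine ⟨T * M * T, ?_⟩
  ext1 Y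
  have h1 : ρ * (Y - T * ρ * Y * (ρ * T)) * ρ = 0 := by
    have : ρ * (Y - T * ρ * Y * (ρ * T)) * ρ
        = ρ * Y * ρ - (ρ * T * ρ) * Y * (ρ * T * ρ) := by noncomm_ring
    rw [this, hi, sub_self]
  have h2 := hf _ h1
  rw [map_sub, sub_eq_zero] at h2
  rw [h2, traceFunctional_apply, traceFunctional_apply]
  calc (M * (T * ρ * Y * (ρ * T))).trace = ((M * (T * ρ * Y)) * (ρ * T)).trace := by
        simp only [Matrix.mul_assoc]
    _ = ((ρ * T) * (M * (T * ρ * Y))).trace := by rw [trace_mul_comm]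
    _ = (ρ * (T * M * T) * ρ * Y).trace := by simp only [Matrix.mul_assoc]

theorem traceFunctional_compression_eq_zero {ρ M Y : QubitOp (Fin n)} (h : ρ * Y * ρ = 0) :
    traceFunctional (ρ * M * ρ) Y = 0 := by
  rw [traceFunctional_apply]
  calc (ρ * M * ρ * Y).trace = (ρ * M * (ρ * Y)).trace := by simp only [Matrix.mul_assoc]
    _ = (ρ * Y * (ρ * M)).trace := by rw [trace_mul_comm]
    _ = (ρ * Y * ρ * M).trace := by simp only [Matrix.mul_assoc]
    _ = 0 := by simp [h]

/-- Trace duality. The operator form suits perturbations and tensoring of witnesses; the functional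
form suits fixing one tensor factor at a time. -/
theorem determinedBelow_iff {ρ : QubitOp (Fin n)} (hρ : ρ.IsHermitian) {k : ℕ} :
    DeterminedBelow k ρ ↔ ∀ M, (∀ X, weight X < k → (ρ * M * ρ * localOp X).trace = 0) →
      ρ * M * ρ = 0 := by
  constructor
  · intro h M hM
    refine traceFunctional_eq_zero fun Y => ?_
    have := h (traceFunctional (ρ * M * ρ)) (fun Y => traceFunctional_compression_eq_zero) hM
    exact congrArg (fun g => g Y) this
  · intro h f hf hX
    obtain ⟨M, rfl⟩ := exists_compression hρ hf
    rw [h M hX]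
    ext1 Y; simp

/-- A state is not determined below weight zero. -/
theorem not_determinedBelow_zero {ρ : QubitOp (Fin n)} (hρ : IsState ρ) :
    ¬ DeterminedBelow 0 ρ := by
  rw [determinedBelow_iff hρ.1.1]
  obtain ⟨T, -, -, hi⟩ := exists_pseudoinverse hρ.1.1
  intro h
  -- No weight is below zero, so the hypothesis is vacuous, while `ρ * T * ρ = ρ` is nonzero.
  have h0 := h T (by simp)
  rw [hi] at h0
  simpa [h0] using hρ.2

/-- The tensor product of two witnesses is a witness: weight below `j + k` means weight below `j` on
the left or below `k` on the right, so one factor of the trace vanishes. -/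
theorem not_determinedBelow_tensor {α : QubitOp (Fin m)} {β : QubitOp (Fin n)}
    (hα : α.IsHermitian) (hβ : β.IsHermitian) {j k : ℕ}
    (h1 : ¬ DeterminedBelow j α) (h2 : ¬ DeterminedBelow k β) :
    ¬ DeterminedBelow (j + k) (tensor α β) := by
  rw [determinedBelow_iff hα] at h1
  rw [determinedBelow_iff hβ] at h2
  have hαβ : (tensor α β).IsHermitian := by
    rw [Matrix.IsHermitian, tensor_conjTranspose, hα.eq, hβ.eq]
  rw [determinedBelow_iff hαβ]
  push Not at h1 h2 ⊢
  obtain ⟨M, hM, hM0⟩ := h1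
  obtain ⟨N, hN, hN0⟩ := h2
  refine ⟨tensor M N, fun X hX => ?_, fun h0 => ?_⟩
  · rw [localOp_eq_tensor, tensor_mul, tensor_mul, tensor_mul, trace_tensor]
    rw [weight_eq_add] at hX
    by_cases h : weight (fun i => X (Fin.castAdd n i)) < j
    · rw [hM _ h, zero_mul]
    · rw [hN _ (by omega), mul_zero]
  · rw [tensor_mul, tensor_mul] at h0
    refine hM0 ?_
    ext a b
    by_contra hab
    refine hN0 ?_
    ext c d
    have := congrFun (congrFun h0 (Fin.append a c)) (Fin.append b d)
    simp only [QubitUDA.tensor, of_apply, Fin.append_left, Fin.append_right, Matrix.zero_apply,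
      mul_eq_zero] at this
    exact this.resolve_left hab

/-- With a left operator of weight at most `j` fixed, `f` vanishes on the right factor by `hβ`; with
an arbitrary right operator fixed, it then vanishes on the left factor by `hα`. -/
theorem DeterminedBelow.tensor {α : QubitOp (Fin m)} {β : QubitOp (Fin n)} {j k : ℕ}
    (hα : DeterminedBelow (j + 1) α) (hβ : DeterminedBelow (k + 1) β) :
    DeterminedBelow (j + k + 1) (tensor α β) := by
  intro f hf hX
  have h1 : ∀ U, weight U < j + 1 → ∀ Y, f (QubitUDA.tensor (localOp U) Y) = 0 := by
    intro U hU Y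
    have : f ∘ₗ tensorBilin m n (localOp U) = 0 := by
      refine hβ _ (fun Z hZ => hf _ ?_) fun V hV => ?_
      · rw [tensorBilin_apply, tensor_mul, tensor_mul, hZ, ← tensorBilin_apply, map_zero]
      · simp only [LinearMap.comp_apply, tensorBilin_apply, tensor_localOp]
        refine hX _ ?_
        rw [weight_append]; omega
    exact congrArg (fun g => g Y) this
  have h2 : ∀ Y X, f (QubitUDA.tensor X Y) = 0 := by
    intro Y X
    have : f ∘ₗ (tensorBilin m n).flip Y = 0 := by
      refine hα _ (fun Z hZ => hf _ ?_) fun V hV => h1 V hV Y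
      rw [LinearMap.flip_apply, tensorBilin_apply, tensor_mul, tensor_mul, hZ,
        ← tensorBilin_apply, map_zero, LinearMap.zero_apply]
    exact congrArg (fun g => g X) this
  exact linearMap_eq_zero_of_localOp fun U => by rw [localOp_eq_tensor, h2]

end Determined

/-! ### Equivalence with unique determination, and LU invariance. -/

section Determination

variable {n m l k : ℕ}

/-- Writing `ρ = Bᴴ * B`, the perturbed operator is `Bᴴ * (1 + ε • (B * M * Bᴴ)) * B`, a state for
small `ε > 0` that is compatible with `ρ`. -/
theorem compression_eq_zero_of_isUDA {ρ : QubitOp (Fin n)} (hk : k ≤ n) (h : IsUDA k ρ)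
    {M : QubitOp (Fin n)} (hM : M.IsHermitian)
    (h0 : ∀ X, weight X < k + 1 → (ρ * M * ρ * localOp X).trace = 0) : ρ * M * ρ = 0 := by
  obtain ⟨⟨hρ, htr⟩, h⟩ := h
  obtain ⟨B, hB⟩ := exists_eq_conjTranspose_mul_self hρ
  obtain ⟨ε, hε, hps⟩ :=
    exists_posSemidef_one_add_smul (isHermitian_mul_mul_conjTranspose B hM)
  have hσ : ρ + (ε : ℂ) • (ρ * M * ρ) = Bᴴ * (1 + (ε : ℂ) • (B * M * Bᴴ)) * B := by
    rw [hB, Matrix.mul_add, Matrix.add_mul, Matrix.mul_one]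
    simp only [Matrix.mul_smul, Matrix.smul_mul, Matrix.mul_assoc]
  have htr0 : (ρ * M * ρ).trace = 0 := by
    simpa [localOp_one] using h0 (fun _ => 1) (by simp)
  have := h (ρ + (ε : ℂ) • (ρ * M * ρ))
    ⟨hσ ▸ hps.conjTranspose_mul_mul_same B, by rw [trace_add, trace_smul, htr0, htr]; simp⟩
    ((compatible_iff hk).mpr fun X hX => by
      rw [Matrix.add_mul, trace_add, Matrix.smul_mul, trace_smul, h0 X hX]; simp)
  rw [add_eq_left, smul_eq_zero] at this
  exact this.resolve_left (by exact_mod_cast hε.ne')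

/-- The perturbation argument needs Hermitian `M`; it is applied to `M + Mᴴ` and `Complex.I • (M -
Mᴴ)`, because taking adjoints preserves weight. -/
theorem IsUDA.determinedBelow {ρ : QubitOp (Fin n)} (hk : k ≤ n) (h : IsUDA k ρ) :
    DeterminedBelow (k + 1) ρ := by
  have hρ : ρ.IsHermitian := h.1.1.1
  rw [determinedBelow_iff hρ]
  intro M hM
  have hM' : ∀ X, weight X < k + 1 → (ρ * Mᴴ * ρ * localOp X).trace = 0 := by
    intro X hX
    have h1 := hM (fun i => (X i)ᴴ)
      ((weight_congr fun i => by rw [conjTranspose_eq_one]).trans_lt hX)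
    have h2 := congrArg star h1
    rw [← trace_conjTranspose, ← localOp_conjTranspose, star_zero] at h2
    rw [trace_mul_comm, ← h2]
    simp only [conjTranspose_mul, conjTranspose_conjTranspose, hρ.eq, Matrix.mul_assoc]
  have h1 : ρ * (M + Mᴴ) * ρ = 0 := by
    refine compression_eq_zero_of_isUDA hk h ?_ fun X hX => ?_
    · simp [Matrix.IsHermitian, add_comm]
    · rw [Matrix.mul_add, Matrix.add_mul, Matrix.add_mul, trace_add, hM X hX, hM' X hX, add_zero]
  have h2 : ρ * (Complex.I • (M - Mᴴ)) * ρ = 0 := by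
    refine compression_eq_zero_of_isUDA hk h ?_ fun X hX => ?_
    · rw [Matrix.IsHermitian, conjTranspose_smul, conjTranspose_sub, conjTranspose_conjTranspose]
      simp only [Complex.star_def, Complex.conj_I]
      rw [neg_smul, ← smul_neg, neg_sub]
    · rw [Matrix.mul_smul, Matrix.smul_mul, Matrix.smul_mul, trace_smul, Matrix.mul_sub,
        Matrix.sub_mul, Matrix.sub_mul, trace_sub, hM X hX, hM' X hX, sub_zero, smul_zero]
  rw [Matrix.mul_smul, Matrix.smul_mul, smul_eq_zero, Matrix.mul_sub, Matrix.sub_mul] at h2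
  rw [Matrix.mul_add, Matrix.add_mul] at h1
  have h3 := h2.resolve_left Complex.I_ne_zero
  have h4 : (2 : ℂ) • (ρ * M * ρ) = 0 := by
    rw [two_smul]
    calc _ = (ρ * M * ρ + ρ * Mᴴ * ρ) + (ρ * M * ρ - ρ * Mᴴ * ρ) := by abel
      _ = 0 := by rw [h1, h3, add_zero]
  exact (smul_eq_zero.mp h4).resolve_left two_ne_zero

theorem isHermitian_mul_of_comm {X : Type} [Fintype X] {A T : Matrix X X ℂ} (hA : A.IsHermitian)
    (hT : T.IsHermitian) (hc : T * A = A * T) : (A * T).IsHermitian := by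
  rw [Matrix.IsHermitian, conjTranspose_mul, hA.eq, hT.eq, hc]

/-- If a positive semidefinite `σ` agrees with `ρ` on a projection killed by `ρ`, then the
complementary projection fixes `σ`. -/
theorem fixed_by_complement {X : Type} [Fintype X] [DecidableEq X] {ρ σ P : Matrix X X ℂ}
    (hσ : σ.PosSemidef) (hP : P.IsHermitian) (hPP : P * P = P) (hρP : ρ * P = ρ)
    (h : (σ * (1 - P)).trace = (ρ * (1 - P)).trace) : σ * P = σ ∧ P * σ = σ := by
  have h0 : (σ * (1 - P)).trace = 0 := by
    rw [h, Matrix.mul_sub, Matrix.mul_one, hρP, sub_self, trace_zero]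
  obtain ⟨h1, h2⟩ := mul_eq_zero_of_trace_eq_zero hσ (P := 1 - P)
    (by rw [Matrix.IsHermitian, conjTranspose_sub, conjTranspose_one, hP.eq])
    (by rw [Matrix.mul_sub, Matrix.sub_mul, Matrix.sub_mul, hPP]; simp) h0
  rw [Matrix.mul_sub, Matrix.mul_one, sub_eq_zero] at h1
  rw [Matrix.sub_mul, Matrix.one_mul, sub_eq_zero] at h2
  exact ⟨h1.symm, h2.symm⟩

/-- Each factor has at most `k` qubits, so a compatible `σ` gives the same expectation as `ρ` to
operators on a single factor. The three factor support projections therefore fix `σ`, and `σ - ρ`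
lives on the support of `ρ`, where `h` applies. -/
theorem isUDA_of_determinedBelow {α : QubitOp (Fin l)} {β : QubitOp (Fin m)}
    {γ : QubitOp (Fin n)} (hα : IsState α) (hβ : IsState β) (hγ : IsState γ)
    (hl : l ≤ k) (hm : m ≤ k) (hn : n ≤ k) (hk : k ≤ l + m + n)
    (h : DeterminedBelow (k + 1) (tensor (tensor α β) γ)) :
    IsUDA k (tensor (tensor α β) γ) := by
  refine ⟨(hα.tensor hβ).tensor hγ, fun σ hσ hc => ?_⟩
  rw [compatible_iff hk] at hc
  obtain ⟨Tα, hTα, hcα, hiα⟩ := exists_pseudoinverse hα.1.1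
  obtain ⟨Tβ, hTβ, hcβ, hiβ⟩ := exists_pseudoinverse hβ.1.1
  obtain ⟨Tγ, hTγ, hcγ, hiγ⟩ := exists_pseudoinverse hγ.1.1
  set ρ := tensor (tensor α β) γ with hρ
  set f := traceFunctional (σ - ρ) with hf
  have hfX : ∀ X, weight X < k + 1 → f (localOp X) = 0 := fun X hX => by
    rw [hf, traceFunctional_apply, Matrix.sub_mul, trace_sub, hc X hX, sub_self]
  have hf0 : ∀ {Y}, f Y = 0 → (σ * Y).trace = (ρ * Y).trace := fun {Y} hY => by
    rwa [hf, traceFunctional_apply, Matrix.sub_mul, trace_sub, sub_eq_zero] at hY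
  have fα : ∀ N, f (tensor (tensor N 1) 1) = 0 := fun N => by
    have : f ∘ₗ (tensorBilin (l + m) n).flip 1 ∘ₗ (tensorBilin l m).flip 1 = 0 :=
      linearMap_eq_zero_of_localOp fun U => by
        simp only [LinearMap.comp_apply, LinearMap.flip_apply, tensorBilin_apply, ← localOp_one,
          tensor_localOp]
        refine hfX _ ?_
        rw [weight_append, weight_append, weight_one, weight_one]
        have := weight_le U; omega
    exact congrArg (fun g => g N) this
  have fβ : ∀ N, f (tensor (tensor 1 N) 1) = 0 := fun N => by
    have : f ∘ₗ (tensorBilin (l + m) n).flip 1 ∘ₗ tensorBilin l m 1 = 0 :=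
      linearMap_eq_zero_of_localOp fun U => by
        simp only [LinearMap.comp_apply, LinearMap.flip_apply, tensorBilin_apply, ← localOp_one,
          tensor_localOp]
        refine hfX _ ?_
        rw [weight_append, weight_append, weight_one, weight_one]
        have := weight_le U; omega
    exact congrArg (fun g => g N) this
  have fγ : ∀ N, f (tensor (tensor 1 1) N) = 0 := fun N => by
    have : f ∘ₗ tensorBilin (l + m) n (tensor 1 1) = 0 :=
      linearMap_eq_zero_of_localOp fun U => by
        simp only [LinearMap.comp_apply, tensorBilin_apply, ← localOp_one, tensor_localOp]
        refine hfX _ ?_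
        rw [weight_append, weight_append, weight_one, weight_one]
        have := weight_le U; omega
    exact congrArg (fun g => g N) this
  have idem : ∀ {r} {A T : QubitOp (Fin r)}, A * T * A = A → A * T * (A * T) = A * T :=
    fun h => by rw [← Matrix.mul_assoc, h]
  have sub1 : ∀ P : QubitOp (Fin l), tensor (tensor (1 - P) 1) 1 = 1 - tensor (tensor P (1 : QubitOp (Fin m)))
      (1 : QubitOp (Fin n)) := fun P => by
    simp only [← tensorBilin_apply, map_sub, LinearMap.sub_apply]
    simp only [tensorBilin_apply, tensor_one]
  have sub2 : ∀ P : QubitOp (Fin m), tensor (tensor 1 (1 - P)) 1 = 1 - tensor (tensor (1 : QubitOp (Fin l)) P)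
      (1 : QubitOp (Fin n)) := fun P => by
    simp only [← tensorBilin_apply, map_sub, LinearMap.sub_apply]
    simp only [tensorBilin_apply, tensor_one]
  have sub3 : ∀ P : QubitOp (Fin n), tensor (tensor 1 1) (1 - P) = 1 - tensor (tensor (1 : QubitOp (Fin l))
      (1 : QubitOp (Fin m))) P := fun P => by
    simp only [← tensorBilin_apply, map_sub]
    simp only [tensorBilin_apply, tensor_one]
  have hA := fixed_by_complement hσ.1 (ρ := ρ) (P := tensor (tensor (α * Tα) 1) 1)
    (by rw [Matrix.IsHermitian, tensor_conjTranspose, tensor_conjTranspose, conjTranspose_one,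
          conjTranspose_one, (isHermitian_mul_of_comm hα.1.1 hTα hcα).eq])
    (by rw [tensor_mul, tensor_mul, idem hiα, Matrix.one_mul, Matrix.one_mul])
    (by rw [hρ, tensor_mul, tensor_mul, ← hcα, ← Matrix.mul_assoc, hiα, Matrix.mul_one,
          Matrix.mul_one])
    (by rw [← sub1]; exact hf0 (fα _))
  have hB := fixed_by_complement hσ.1 (ρ := ρ) (P := tensor (tensor 1 (β * Tβ)) 1)
    (by rw [Matrix.IsHermitian, tensor_conjTranspose, tensor_conjTranspose, conjTranspose_one,
          conjTranspose_one, (isHermitian_mul_of_comm hβ.1.1 hTβ hcβ).eq])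
    (by rw [tensor_mul, tensor_mul, idem hiβ, Matrix.one_mul, Matrix.one_mul])
    (by rw [hρ, tensor_mul, tensor_mul, ← hcβ, ← Matrix.mul_assoc, hiβ, Matrix.mul_one,
          Matrix.mul_one])
    (by rw [← sub2]; exact hf0 (fβ _))
  have hC := fixed_by_complement hσ.1 (ρ := ρ) (P := tensor (tensor 1 1) (γ * Tγ))
    (by rw [Matrix.IsHermitian, tensor_conjTranspose, tensor_conjTranspose, conjTranspose_one,
          conjTranspose_one, (isHermitian_mul_of_comm hγ.1.1 hTγ hcγ).eq])
    (by rw [tensor_mul, tensor_mul, idem hiγ, Matrix.one_mul, Matrix.one_mul])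
    (by rw [hρ, tensor_mul, tensor_mul, ← hcγ, ← Matrix.mul_assoc, hiγ, Matrix.mul_one,
          Matrix.mul_one])
    (by rw [← sub3]; exact hf0 (fγ _))
  set T := tensor (tensor Tα Tβ) Tγ with hT
  -- The product of the three factor projections is the support projection of `ρ`.
  have hP : tensor (tensor (α * Tα) 1) 1 * tensor (tensor 1 (β * Tβ)) 1
      * tensor (tensor 1 1) (γ * Tγ) = ρ * T := by
    simp only [hρ, hT, tensor_mul, Matrix.one_mul, Matrix.mul_one]
  have hP' : tensor (tensor (α * Tα) 1) 1 * tensor (tensor 1 (β * Tβ)) 1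
      * tensor (tensor 1 1) (γ * Tγ) = T * ρ := by
    simp only [hρ, hT, tensor_mul, Matrix.one_mul, Matrix.mul_one, hcα, hcβ, hcγ]
  have hcomm : ρ * T = T * ρ := hP.symm.trans hP'
  have hσr : σ * (ρ * T) = σ := by
    rw [← hP, ← Matrix.mul_assoc, ← Matrix.mul_assoc, hA.1, hB.1, hC.1]
  have hσl : T * ρ * σ = σ := by
    rw [← hP', Matrix.mul_assoc, hC.2, Matrix.mul_assoc, hB.2, hA.2]
  have hρρ : ρ * T * ρ = ρ := by
    simp only [hρ, hT, tensor_mul, hiα, hiβ, hiγ]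
  have supp : ∀ Z Y, Z * (ρ * T) = Z → T * ρ * Z = Z → ρ * Y * ρ = 0 → (Z * Y).trace = 0 := by
    intro Z Y h1 h2 hY
    calc (Z * Y).trace = (T * ρ * (Z * (ρ * T)) * Y).trace := by rw [h1, h2]
      _ = ((T * ρ) * (Z * (ρ * T) * Y)).trace := by simp only [Matrix.mul_assoc]
      _ = (Z * (ρ * T) * Y * (T * ρ)).trace := by rw [trace_mul_comm]
      _ = (Z * (T * ρ) * Y * (ρ * T)).trace := by rw [hcomm]
      _ = (Z * (T * (ρ * Y * ρ) * T)).trace := by simp only [Matrix.mul_assoc]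
      _ = 0 := by simp [hY]
  have := h f (fun Y hY => by
    rw [hf, traceFunctional_apply, Matrix.sub_mul, trace_sub, supp σ Y hσr hσl hY,
      supp ρ Y (by rw [hcomm, ← Matrix.mul_assoc, hρρ])
        (by rw [← hcomm, hρρ]) hY, sub_zero]) hfX
  exact sub_eq_zero.mp (traceFunctional_eq_zero fun Y => congrArg (fun g => g Y) this)

theorem LUEquiv.symm {ρ σ : QubitOp (Fin n)} (h : LUEquiv ρ σ) : LUEquiv σ ρ := by
  obtain ⟨U, hU, rfl⟩ := h
  have h1 : localOp (fun i => (U i)ᴴ) * localOp U = 1 := by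
    rw [localOp_mul, ← localOp_one]
    congr 1; funext i
    exact mem_unitaryGroup_iff'.mp (hU i)
  refine ⟨fun i => (U i)ᴴ, fun i => Unitary.star_mem (hU i), ?_⟩
  rw [localOp_conjTranspose (fun i => (U i)ᴴ)]
  simp only [conjTranspose_conjTranspose]
  rw [localOp_conjTranspose U]
  calc σ = (localOp (fun i => (U i)ᴴ) * localOp U) * σ
          * (localOp (fun i => (U i)ᴴ) * localOp U) := by rw [h1]; simp
    _ = _ := by simp only [Matrix.mul_assoc]

/-- Conjugation by local unitaries preserves weight, since it sends exactly the identity to the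
identity in each slot. -/
theorem LUEquiv.determinedBelow {ρ σ : QubitOp (Fin n)} (h : LUEquiv ρ σ)
    (hσ : DeterminedBelow k σ) : DeterminedBelow k ρ := by
  obtain ⟨U, hU, rfl⟩ := h
  have h1 : (localOp U)ᴴ * localOp U = 1 := by
    rw [localOp_conjTranspose, localOp_mul, ← localOp_one]
    congr 1; funext i
    exact mem_unitaryGroup_iff'.mp (hU i)
  have h2 : localOp U * (localOp U)ᴴ = 1 := mul_eq_one_comm.mp h1
  set L := localOp U
  intro f hf hX
  have hg : f ∘ₗ LinearMap.mulLeft ℂ L ∘ₗ LinearMap.mulRight ℂ Lᴴ = 0 := by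
    refine hσ _ (fun Y hY => hf _ ?_) fun X hw => ?_
    · simp only [LinearMap.comp_apply, LinearMap.mulLeft_apply, LinearMap.mulRight_apply]
      calc L * σ * Lᴴ * (L * (Y * Lᴴ)) * (L * σ * Lᴴ)
          = L * (σ * (Lᴴ * L) * Y * (Lᴴ * L) * σ) * Lᴴ := by simp only [Matrix.mul_assoc]
        _ = 0 := by simp [h1, hY]
    · simp only [LinearMap.comp_apply, LinearMap.mulLeft_apply, LinearMap.mulRight_apply]
      rw [localOp_conjTranspose, localOp_mul, localOp_mul]
      refine hX _ (lt_of_eq_of_lt (weight_congr fun i => ?_) hw)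
      have e1 : (U i)ᴴ * U i = 1 := mem_unitaryGroup_iff'.mp (hU i)
      have e2 : U i * (U i)ᴴ = 1 := mul_eq_one_comm.mp e1
      constructor
      · intro h
        calc X i = ((U i)ᴴ * U i) * X i * ((U i)ᴴ * U i) := by simp [e1]
          _ = (U i)ᴴ * (U i * (X i * (U i)ᴴ)) * U i := by simp only [Matrix.mul_assoc]
          _ = 1 := by rw [h, Matrix.mul_one, e1]
      · intro h; rw [h, Matrix.one_mul, e2]
  ext1 Y
  have := congrArg (fun g => g (Lᴴ * Y * L)) hg
  simp only [LinearMap.comp_apply, LinearMap.mulLeft_apply, LinearMap.mulRight_apply] at this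
  rwa [show L * (Lᴴ * Y * L * Lᴴ) = (L * Lᴴ) * Y * (L * Lᴴ) by simp only [Matrix.mul_assoc], h2,
    Matrix.one_mul, Matrix.mul_one] at this

theorem LUEquiv.isState {ρ σ : QubitOp (Fin n)} (h : LUEquiv ρ σ) (hσ : IsState σ) :
    IsState ρ := by
  obtain ⟨U, hU, rfl⟩ := h
  refine ⟨hσ.1.mul_mul_conjTranspose_same _, ?_⟩
  have h1 : (localOp U)ᴴ * localOp U = 1 := by
    rw [localOp_conjTranspose, localOp_mul, ← localOp_one]
    congr 1; funext i
    exact mem_unitaryGroup_iff'.mp (hU i)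
  rw [Matrix.mul_assoc, trace_mul_comm, Matrix.mul_assoc, h1, Matrix.mul_one, hσ.2]

theorem LUEquiv.refl (ρ : QubitOp (Fin n)) : LUEquiv ρ ρ :=
  ⟨fun _ => 1, fun _ => one_mem _, by simp [localOp_one]⟩

theorem LUEquiv.tensor {α α' : QubitOp (Fin m)} {β β' : QubitOp (Fin n)} (hα : LUEquiv α α')
    (hβ : LUEquiv β β') : LUEquiv (tensor α β) (tensor α' β') := by
  obtain ⟨U, hU, rfl⟩ := hα
  obtain ⟨V, hV, rfl⟩ := hβ
  refine ⟨Fin.append U V, fun i => ?_, ?_⟩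
  · refine Fin.addCases (fun i => ?_) (fun i => ?_) i
    · simpa using hU i
    · simpa using hV i
  · rw [← tensor_localOp, tensor_conjTranspose, tensor_mul, tensor_mul]

end Determination

/-! ### Pure states are those determined by the trace alone. -/

section Pure

variable {n : ℕ}

/-- The minors through the pivot `j` vanish, so column `j` divided by `√(ρ j j)` is the state
vector. -/
theorem isPure_of_mul_eq {X : Type} [Fintype X] {ρ : Matrix X X ℂ} (hρ : IsState ρ) {j : X}
    (hj : ρ j j ≠ 0) (h : ∀ x y, ρ x j * ρ j y = ρ j j * ρ x y) : IsPure ρ := by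
  have hpos : 0 < ρ j j := lt_of_le_of_ne hρ.1.diag_nonneg (Ne.symm hj)
  obtain ⟨r, hr, hrj⟩ : ∃ r : ℝ, 0 < r ∧ (r : ℂ) = ρ j j :=
    ⟨_, (Complex.pos_iff.mp hpos).1, Complex.ext rfl (Complex.pos_iff.mp hpos).2⟩
  have hs : ((Real.sqrt r : ℝ) : ℂ) * (Real.sqrt r : ℝ) = r := by
    rw [← Complex.ofReal_mul, Real.mul_self_sqrt hr.le]
  have hs0 : ((Real.sqrt r : ℝ) : ℂ) ≠ 0 := by
    simpa using (Real.sqrt_pos.mpr hr).ne'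
  have e : ρ = vecMulVec (fun x => ρ x j / (Real.sqrt r : ℝ))
      (star fun x => ρ x j / (Real.sqrt r : ℝ)) := by
    ext x y
    have h1 : star (ρ y j) = ρ j y := hρ.1.1.apply j y
    simp only [vecMulVec_apply, Pi.star_apply, star_div₀, h1, Complex.star_def,
      Complex.conj_ofReal]
    rw [div_mul_div_comm, hs, h, ← hrj, mul_div_cancel_left₀]
    rwa [hrj]
  refine ⟨_, ?_, e⟩
  have := hρ.2
  rw [e, trace_vecMulVec, dotProduct_comm] at this
  exact this

theorem exists_diag_ne_zero {X : Type} [Fintype X] {ρ : Matrix X X ℂ} (hρ : IsState ρ) :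
    ∃ j, ρ j j ≠ 0 := by
  by_contra! h
  have := hρ.2
  simp [trace, h] at this

/-- Only the identity has weight zero, so each `ρ * M * ρ` is fixed by its trace and is a multiple
of `ρ`. The choice `M = single j j 1` gives the rank-one relations. -/
theorem DeterminedBelow.isPure {ρ : QubitOp (Fin n)} (hρ : IsState ρ)
    (h : DeterminedBelow 1 ρ) : IsPure ρ := by
  rw [determinedBelow_iff hρ.1.1] at h
  obtain ⟨T, -, -, hi⟩ := exists_pseudoinverse hρ.1.1
  obtain ⟨j, hj⟩ := exists_diag_ne_zero hρ
  have key : ∀ M, ρ * M * ρ = (ρ * M * ρ).trace • ρ := by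
    intro M
    have e : ρ * (M - (ρ * M * ρ).trace • T) * ρ = ρ * M * ρ - (ρ * M * ρ).trace • ρ := by
      rw [Matrix.mul_sub, Matrix.sub_mul, Matrix.mul_smul, Matrix.smul_mul, hi]
    have := h (M - (ρ * M * ρ).trace • T) (fun X hX => by
      have hX1 : localOp X = 1 := by
        rw [← localOp_one]
        congr 1; funext i
        by_contra hne
        rw [Nat.lt_one_iff, weight, Finset.sum_eq_zero_iff] at hX
        simpa [hne] using hX i (Finset.mem_univ i)
      rw [e, hX1, Matrix.mul_one, trace_sub, trace_smul, hρ.2]; simp)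
    rwa [e, sub_eq_zero] at this
  have h1 : ∀ x y, ρ x j * ρ j y = (ρ * single j j 1 * ρ).trace * ρ x y := by
    intro x y
    have := congrFun (congrFun (key (single j j 1)) x) y
    rw [Matrix.smul_apply, smul_eq_mul] at this
    rw [← this, mul_apply, Finset.sum_eq_single j] <;> simp +contextual
  have h2 : (ρ * single j j 1 * ρ).trace = ρ j j :=
    (mul_right_cancel₀ hj (h1 j j)).symm
  exact isPure_of_mul_eq hρ hj fun x y => by rw [h1, h2]

theorem IsPure.mul_mul {X : Type} [Fintype X] {ρ : Matrix X X ℂ} (h : IsPure ρ)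
    (Y : Matrix X X ℂ) : ρ * Y * ρ = (ρ * Y).trace • ρ := by
  obtain ⟨ψ, -, rfl⟩ := h
  rw [vecMulVec_mul, vecMulVec_mul_vecMulVec, trace_vecMulVec, dotProduct_comm]
  ext i j
  simp [vecMulVec_apply]
  ring

theorem IsPure.mul_self {X : Type} [Fintype X] [DecidableEq X] {ρ : Matrix X X ℂ}
    (h : IsPure ρ) : ρ * ρ = ρ := by
  have h1 := h.mul_mul 1
  obtain ⟨ψ, hψ, rfl⟩ := h
  rw [Matrix.mul_one, trace_vecMulVec, dotProduct_comm, hψ, one_smul] at h1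
  exact h1

theorem IsPure.isState {X : Type} [Fintype X] [DecidableEq X] {ρ : Matrix X X ℂ}
    (h : IsPure ρ) : IsState ρ := by
  obtain ⟨ψ, hψ, rfl⟩ := h
  exact ⟨posSemidef_vecMulVec_self_star ψ, by rw [trace_vecMulVec, dotProduct_comm, hψ]⟩

/-- For pure `ρ` the compressions of `Y` and `(ρ * Y).trace • 1` agree, so `f` is governed by `f 1 =
0`. -/
theorem IsPure.determinedBelow {ρ : QubitOp (Fin n)} (h : IsPure ρ) : DeterminedBelow 1 ρ := by
  intro f hf hX
  have h1 : f 1 = 0 := by simpa [localOp_one] using hX (fun _ => 1) (by simp)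
  ext1 Y
  have h2 := hf (Y - (ρ * Y).trace • 1) (by
    rw [Matrix.mul_sub, Matrix.sub_mul, h.mul_mul, Matrix.mul_smul, Matrix.smul_mul,
      Matrix.mul_one, h.mul_self, sub_self])
  rw [map_sub, map_smul, h1, smul_zero, sub_zero] at h2
  exact h2

end Pure

/-! ### One-qubit states: pure or of rank two. -/

section OneQubit

theorem IsPure.submatrix {X Y : Type} [Fintype X] [Fintype Y] {ρ : Matrix X X ℂ} (h : IsPure ρ)
    (e : Y ≃ X) : IsPure (ρ.submatrix e e) := by
  obtain ⟨ψ, hψ, rfl⟩ := h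
  exact ⟨ψ ∘ e, by rw [← hψ]; exact Equiv.sum_comp e fun i => star ψ i * ψ i, rfl⟩

theorem IsState.submatrix {X Y : Type} [Fintype X] [Fintype Y] {ρ : Matrix X X ℂ}
    (h : IsState ρ) (e : Y ≃ X) : IsState (ρ.submatrix e e) :=
  ⟨h.1.submatrix e, by rw [← h.2]; exact Equiv.sum_comp e fun i => ρ i i⟩

theorem isPure_submatrix_iff {X Y : Type} [Fintype X] [Fintype Y] {ρ : Matrix X X ℂ}
    (e : Y ≃ X) : IsPure (ρ.submatrix e e) ↔ IsPure ρ :=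
  ⟨fun h => by simpa using h.submatrix e.symm, fun h => h.submatrix e⟩

theorem isPure_of_det_eq_zero {ρ : Matrix (Fin 2) (Fin 2) ℂ} (hρ : IsState ρ)
    (h : ρ.det = 0) : IsPure ρ := by
  obtain ⟨j, hj⟩ := exists_diag_ne_zero hρ
  refine isPure_of_mul_eq hρ hj fun x y => ?_
  rw [det_fin_two] at h
  fin_cases j <;> fin_cases x <;> fin_cases y <;>
    simp only [Fin.zero_eta, Fin.mk_one] <;> first | ring1 | linear_combination -h

/-- Basis labels of one qubit. -/
def oneQubit : (Fin 1 → Fin 2) ≃ Fin 2 := Equiv.funUnique (Fin 1) (Fin 2)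

theorem isPure_or_rank_eq_two {ρ : QubitOp (Fin 1)} (hρ : IsState ρ) :
    IsPure ρ ∨ ρ.rank = 2 := by
  have hs := hρ.submatrix oneQubit.symm
  by_cases h : (ρ.submatrix oneQubit.symm oneQubit.symm).det = 0
  · exact .inl ((isPure_submatrix_iff _).mp (isPure_of_det_eq_zero hs h))
  · right
    rw [← rank_submatrix ρ oneQubit.symm oneQubit.symm, rank_of_isUnit _
      ((isUnit_iff_isUnit_det _).mpr (Ne.isUnit h)), Fintype.card_fin]

theorem eq_localOp_oneQubit (X : QubitOp (Fin 1)) :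
    X = localOp fun _ => X.submatrix oneQubit.symm oneQubit.symm := by
  ext x y
  have : ∀ x : Fin 1 → Fin 2, oneQubit.symm (x 0) = x := fun x => oneQubit.symm_apply_apply x
  simp [localOp_apply, this]

end OneQubit

/-! ### One-qubit marginals, and splitting off a pure factor. -/

section Reduced

variable {n m : ℕ}

/-- Basis labels of the subsystem consisting of the single qubit `i`. -/
def singletonArrow (i : Fin n) : Fin 2 ≃ ({j // j ∈ ({i} : Finset (Fin n))} → Fin 2) where
  toFun a _ := a
  invFun x := x ⟨i, Finset.mem_singleton_self i⟩
  left_inv _ := rfl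
  right_inv x := by
    funext ⟨j, hj⟩
    obtain rfl := Finset.mem_singleton.mp hj
    rfl

/-- The reduced state of the single qubit `i`. -/
def reduced (ρ : QubitOp (Fin n)) (i : Fin n) : Matrix (Fin 2) (Fin 2) ℂ :=
  (marginal ρ {i}).submatrix (singletonArrow i) (singletonArrow i)

theorem isPure_marginal_singleton (ρ : QubitOp (Fin n)) (i : Fin n) :
    IsPure (marginal ρ {i}) ↔ IsPure (reduced ρ i) :=
  (isPure_submatrix_iff _).symm

theorem trace_mul_localOp_update (ρ : QubitOp (Fin n)) (i : Fin n)
    (Z : Matrix (Fin 2) (Fin 2) ℂ) :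
    (ρ * localOp (Function.update (fun _ => 1) i Z)).trace = (reduced ρ i * Z).trace := by
  rw [trace_mul_localOp ρ {i} (fun j hj => by
    rw [Function.update_of_ne (by simpa using hj)]), ← (singletonArrow i).sum_comp]
  simp only [trace, diag_apply, mul_apply]
  refine Finset.sum_congr rfl fun a _ => ?_
  rw [← (singletonArrow i).sum_comp]
  refine Finset.sum_congr rfl fun b _ => ?_
  congr 1
  have := Finset.prod_coe_sort {i} fun j =>
    (Function.update (fun _ => (1 : Matrix (Fin 2) (Fin 2) ℂ)) i Z) j b a
  rw [Finset.prod_singleton, Function.update_self] at this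
  exact this

/-- Identifies marginals through expectation values instead of partial-trace sums. -/
theorem reduced_eq_of_trace {ρ : QubitOp (Fin n)} {i : Fin n} {A : Matrix (Fin 2) (Fin 2) ℂ}
    (h : ∀ Z, (ρ * localOp (Function.update (fun _ => 1) i Z)).trace = (A * Z).trace) :
    reduced ρ i = A := by
  refine sub_eq_zero.mp (traceFunctional_eq_zero fun Z => ?_)
  rw [Matrix.sub_mul, trace_sub, ← h, trace_mul_localOp_update, sub_self]

theorem IsState.reduced {ρ : QubitOp (Fin n)} (h : IsState ρ) (i : Fin n) :
    IsState (reduced ρ i) := by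
  refine ⟨PosSemidef.submatrix ?_ _, ?_⟩
  · have : marginal ρ {i} = ∑ z, ρ.submatrix (fun x => glue {i} x z) (fun x => glue {i} x z) := by
      ext x y
      simp [marginal, Matrix.sum_apply]
    rw [this]
    exact posSemidef_sum _ fun z _ => h.1.submatrix _
  · have := trace_mul_localOp_update ρ i 1
    rw [Matrix.mul_one, Function.update_eq_self_iff.mpr rfl, localOp_one, Matrix.mul_one, h.2] at this
    exact this.symm

theorem update_castAdd (i : Fin m) (Z : Matrix (Fin 2) (Fin 2) ℂ) :
    Function.update (fun _ : Fin (m + n) => 1) (Fin.castAdd n i) Z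
      = Fin.append (Function.update (fun _ => 1) i Z) (fun _ => 1) := by
  funext j
  refine Fin.addCases (fun j => ?_) (fun j => ?_) j
  · simp [Function.update_apply]
  · rw [Fin.append_right, Function.update_of_ne]
    intro h; have := congrArg Fin.val h; simp at this; omega

theorem update_natAdd (i : Fin n) (Z : Matrix (Fin 2) (Fin 2) ℂ) :
    Function.update (fun _ : Fin (m + n) => 1) (Fin.natAdd m i) Z
      = Fin.append (fun _ => 1) (Function.update (fun _ => 1) i Z) := by
  funext j
  refine Fin.addCases (fun j => ?_) (fun j => ?_) j
  · rw [Fin.append_left, Function.update_of_ne]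
    intro h; have := congrArg Fin.val h; simp at this; omega
  · simp [Function.update_apply]

theorem reduced_tensor_castAdd (α : QubitOp (Fin m)) {β : QubitOp (Fin n)} (hβ : β.trace = 1)
    (i : Fin m) : reduced (tensor α β) (Fin.castAdd n i) = reduced α i :=
  reduced_eq_of_trace fun Z => by
    rw [update_castAdd, ← tensor_localOp, tensor_mul, trace_tensor, localOp_one, Matrix.mul_one,
      hβ, mul_one, trace_mul_localOp_update]

theorem reduced_tensor_natAdd {α : QubitOp (Fin m)} (hα : α.trace = 1) (β : QubitOp (Fin n))
    (i : Fin n) : reduced (tensor α β) (Fin.natAdd m i) = reduced β i :=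
  reduced_eq_of_trace fun Z => by
    rw [update_natAdd, ← tensor_localOp, tensor_mul, trace_tensor, localOp_one, Matrix.mul_one,
      hα, one_mul, trace_mul_localOp_update]

theorem reduced_oneQubit (α : QubitOp (Fin 1)) :
    reduced α 0 = α.submatrix oneQubit.symm oneQubit.symm := by
  refine reduced_eq_of_trace fun Z => ?_
  have h1 : localOp (Function.update (fun _ : Fin 1 => 1) 0 Z) = Z.submatrix oneQubit oneQubit := by
    rw [eq_localOp_oneQubit (Z.submatrix oneQubit oneQubit)]
    congr 1
    funext i
    rw [Subsingleton.elim i 0, Function.update_self]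
    simp
  rw [h1]
  have h2 : α = (α.submatrix oneQubit.symm oneQubit.symm).submatrix oneQubit oneQubit := by simp
  conv_lhs => rw [h2]
  rw [submatrix_mul_equiv]
  exact oneQubit.sum_comp fun i => (α.submatrix oneQubit.symm oneQubit.symm * Z) i i

theorem isPure_reduced_oneQubit (α : QubitOp (Fin 1)) : IsPure (reduced α 0) ↔ IsPure α := by
  rw [reduced_oneQubit, isPure_submatrix_iff]

theorem IsPure.unitary_conj {X : Type} [Fintype X] [DecidableEq X] {ρ U : Matrix X X ℂ}
    (h : IsPure ρ) (hU : Uᴴ * U = 1) : IsPure (U * ρ * Uᴴ) := by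
  obtain ⟨ψ, hψ, rfl⟩ := h
  refine ⟨U *ᵥ ψ, ?_, ?_⟩
  · rw [star_mulVec, ← dotProduct_mulVec, mulVec_mulVec, hU, one_mulVec, hψ]
  · rw [mul_vecMulVec, vecMulVec_mul, star_mulVec]

theorem LUEquiv.isPure_reduced {ρ σ : QubitOp (Fin n)} (h : LUEquiv ρ σ) {i : Fin n}
    (hσ : IsPure (reduced σ i)) : IsPure (reduced ρ i) := by
  obtain ⟨U, hU, rfl⟩ := h
  have e1 : ∀ j, (U j)ᴴ * U j = 1 := fun j => mem_unitaryGroup_iff'.mp (hU j)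
  suffices reduced (localOp U * σ * (localOp U)ᴴ) i = U i * reduced σ i * (U i)ᴴ by
    rw [this]; exact hσ.unitary_conj (e1 i)
  refine reduced_eq_of_trace fun Z => ?_
  have h1 : (localOp U)ᴴ * localOp (Function.update (fun _ => 1) i Z) * localOp U
      = localOp (Function.update (fun _ => 1) i ((U i)ᴴ * Z * U i)) := by
    rw [localOp_conjTranspose, localOp_mul, localOp_mul]
    congr 1; funext j
    by_cases hj : j = i
    · subst hj; simp
    · simp [Function.update_of_ne hj, e1]
  calc _ = (localOp U * (σ * ((localOp U)ᴴ
          * localOp (Function.update (fun _ => 1) i Z)))).trace := by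
        simp only [Matrix.mul_assoc]
    _ = (σ * ((localOp U)ᴴ
          * localOp (Function.update (fun _ => 1) i Z) * localOp U)).trace := by
        rw [trace_mul_comm]; simp only [Matrix.mul_assoc]
    _ = (reduced σ i * ((U i)ᴴ * Z * U i)).trace := by rw [h1, trace_mul_localOp_update]
    _ = (reduced σ i * ((U i)ᴴ * Z) * U i).trace := by simp only [Matrix.mul_assoc]
    _ = (U i * (reduced σ i * ((U i)ᴴ * Z))).trace := by rw [trace_mul_comm]
    _ = _ := by simp only [Matrix.mul_assoc]

theorem mul_eq_of_trace_eq_one {X : Type} [Fintype X] [DecidableEq X] {ρ P : Matrix X X ℂ}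
    (hρ : IsState ρ) (hP : P.IsHermitian) (hPP : P * P = P) (h : (ρ * P).trace = 1) :
    P * ρ * P = ρ := by
  obtain ⟨h1, h2⟩ := mul_eq_zero_of_trace_eq_zero hρ.1 (P := 1 - P)
    (by rw [Matrix.IsHermitian, conjTranspose_sub, conjTranspose_one, hP.eq])
    (by rw [Matrix.mul_sub, Matrix.sub_mul, Matrix.sub_mul, hPP]; simp)
    (by rw [Matrix.mul_sub, Matrix.mul_one, trace_sub, h, hρ.2, sub_self])
  rw [Matrix.mul_sub, Matrix.mul_one, sub_eq_zero] at h1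
  rw [Matrix.sub_mul, Matrix.one_mul, sub_eq_zero] at h2
  rw [← h2, ← h1]

/-- Trace one against the projection `tensor φ 1` means that compressing by it fixes `β`. That
projection is `B * Bᴴ` for the isometry `B` that tensors with `ψ`, so `τ = Bᴴ * β * B`. -/
theorem exists_eq_tensor_left {φ : QubitOp (Fin m)} {β : QubitOp (Fin (m + n))} (hφ : IsPure φ)
    (hβ : IsState β) (h : (β * tensor φ 1).trace = 1) :
    ∃ τ : QubitOp (Fin n), IsState τ ∧ β = tensor φ τ := by
  have h1 := mul_eq_of_trace_eq_one hβ (P := tensor φ 1)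
    (by rw [Matrix.IsHermitian, tensor_conjTranspose, hφ.isState.1.1.eq, conjTranspose_one])
    (by rw [tensor_mul, hφ.mul_self, Matrix.one_mul]) h
  have htr := hφ.isState.2
  obtain ⟨ψ, hψ, rfl⟩ := hφ
  let B : Matrix (Fin (m + n) → Fin 2) (Fin n → Fin 2) ℂ := of fun x c =>
    ψ (fun i => x (Fin.castAdd n i)) * if (fun j => x (Fin.natAdd m j)) = c then 1 else 0
  have hBτ : ∀ τ : QubitOp (Fin n), B * τ * Bᴴ = tensor (vecMulVec ψ (star ψ)) τ := by
    intro τ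
    ext x y
    simp only [B, QubitUDA.tensor, mul_apply, vecMulVec_apply, of_apply, conjTranspose_apply]
    simp [apply_ite]
    ring
  have hB : tensor (vecMulVec ψ (star ψ)) 1 = B * Bᴴ := by
    rw [← hBτ, Matrix.mul_one]
  have h2 : β = tensor (vecMulVec ψ (star ψ)) (Bᴴ * β * B) := by
    rw [← hBτ, ← h1, hB]
    rw [hB] at h1
    conv_rhs => rw [h1]
    simp only [Matrix.mul_assoc]
  refine ⟨Bᴴ * β * B, ⟨hβ.1.conjTranspose_mul_mul_same B, ?_⟩, h2⟩
  have h3 := hβ.2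
  rwa [h2, trace_tensor, htr, one_mul] at h3

theorem exists_eq_tensor_right {φ : QubitOp (Fin n)} {β : QubitOp (Fin (m + n))} (hφ : IsPure φ)
    (hβ : IsState β) (h : (β * tensor 1 φ).trace = 1) :
    ∃ τ : QubitOp (Fin m), IsState τ ∧ β = tensor τ φ := by
  have h1 := mul_eq_of_trace_eq_one hβ (P := tensor 1 φ)
    (by rw [Matrix.IsHermitian, tensor_conjTranspose, hφ.isState.1.1.eq, conjTranspose_one])
    (by rw [tensor_mul, hφ.mul_self, Matrix.one_mul]) h
  have htr := hφ.isState.2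
  obtain ⟨ψ, hψ, rfl⟩ := hφ
  let B : Matrix (Fin (m + n) → Fin 2) (Fin m → Fin 2) ℂ := of fun x c =>
    ψ (fun j => x (Fin.natAdd m j)) * if (fun i => x (Fin.castAdd n i)) = c then 1 else 0
  have hBτ : ∀ τ : QubitOp (Fin m), B * τ * Bᴴ = tensor τ (vecMulVec ψ (star ψ)) := by
    intro τ
    ext x y
    simp only [B, QubitUDA.tensor, mul_apply, vecMulVec_apply, of_apply, conjTranspose_apply]
    simp [apply_ite]
    ring
  have hB : tensor 1 (vecMulVec ψ (star ψ)) = B * Bᴴ := by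
    rw [← hBτ, Matrix.mul_one]
  have h2 : β = tensor (Bᴴ * β * B) (vecMulVec ψ (star ψ)) := by
    rw [← hBτ, ← h1, hB]
    rw [hB] at h1
    conv_rhs => rw [h1]
    simp only [Matrix.mul_assoc]
  refine ⟨Bᴴ * β * B, ⟨hβ.1.conjTranspose_mul_mul_same B, ?_⟩, h2⟩
  have h3 := hβ.2
  rwa [h2, trace_tensor, htr, mul_one] at h3

theorem exists_product_of_isPure_reduced_zero {β : QubitOp (Fin 2)} (hβ : IsState β)
    (h : IsPure (reduced β 0)) :
    ∃ φ τ : QubitOp (Fin 1), IsPure φ ∧ IsState τ ∧ β = product11 φ τ := by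
  have hφ := h.submatrix oneQubit
  obtain ⟨τ, hτ, e⟩ := exists_eq_tensor_left (m := 1) (n := 1) (β := β) hφ hβ (by
    have h1 := trace_mul_localOp_update β 0 (reduced β 0)
    rw [h.mul_self, (hβ.reduced 0).2] at h1
    rw [← h1, eq_localOp_oneQubit ((reduced β 0).submatrix oneQubit oneQubit), ← localOp_one,
      tensor_localOp]
    congr 3
    funext j
    fin_cases j
    · simp [Fin.append, Fin.addCases]
    · simp [Fin.append, Fin.addCases])
  exact ⟨_, τ, hφ, hτ, e⟩

theorem exists_product_of_isPure_reduced_one {β : QubitOp (Fin 2)} (hβ : IsState β)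
    (h : IsPure (reduced β 1)) :
    ∃ φ τ : QubitOp (Fin 1), IsPure φ ∧ IsState τ ∧ β = product11 τ φ := by
  have hφ := h.submatrix oneQubit
  obtain ⟨τ, hτ, e⟩ := exists_eq_tensor_right (m := 1) (n := 1) (β := β) hφ hβ (by
    have h1 := trace_mul_localOp_update β 1 (reduced β 1)
    rw [h.mul_self, (hβ.reduced 1).2] at h1
    rw [← h1, eq_localOp_oneQubit ((reduced β 1).submatrix oneQubit oneQubit), ← localOp_one,
      tensor_localOp]
    congr 3
    funext j
    fin_cases j
    · simp [Fin.append, Fin.addCases]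
    · simp [Fin.append, Fin.addCases])
  exact ⟨_, τ, hφ, hτ, e⟩

theorem determinedBelow_two_product11_left {φ τ : QubitOp (Fin 1)} (hφ : IsPure φ) :
    DeterminedBelow 2 (product11 φ τ) :=
  DeterminedBelow.tensor (j := 0) (k := 1) hφ.determinedBelow
    (determinedBelow_of_lt τ one_lt_two)

theorem determinedBelow_two_product11_right {φ τ : QubitOp (Fin 1)} (hφ : IsPure φ) :
    DeterminedBelow 2 (product11 τ φ) :=
  DeterminedBelow.tensor (j := 1) (k := 0) (determinedBelow_of_lt τ one_lt_two)
    hφ.determinedBelow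

end Reduced

/-! ### Rank bounds. -/

section Rank

theorem isPure_or_two_le_rank {X : Type} [Fintype X] [DecidableEq X] {ρ : Matrix X X ℂ}
    (hρ : IsState ρ) : IsPure ρ ∨ 2 ≤ ρ.rank := by
  obtain ⟨U, d, -, -, h3, h4⟩ := exists_unitary_diagonalization hρ.1.1
  by_cases hr : 2 ≤ ρ.rank
  · exact .inr hr
  left
  have hsub : Subsingleton {i // d i ≠ 0} :=
    Fintype.card_le_one_iff_subsingleton.mp (by omega)
  obtain ⟨k, hk⟩ := exists_diag_ne_zero hρ
  have hentry : ∀ x y, ρ x y = ∑ i, U x i * d i * star (U y i) := by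
    intro x y
    conv_lhs => rw [h3]
    simp [mul_apply (N := Uᴴ), mul_diagonal]
  obtain ⟨j, hj⟩ : ∃ j, d j ≠ 0 := by
    by_contra! h
    exact hk (by simp [hentry, h])
  have hentry' : ∀ x y, ρ x y = U x j * d j * star (U y j) := by
    intro x y
    rw [hentry, Finset.sum_eq_single j]
    · intro i _ hi
      have : d i = 0 := by
        by_contra h
        exact hi (congrArg Subtype.val (hsub.elim ⟨i, h⟩ ⟨j, hj⟩))
      simp [this]
    · simp
  refine isPure_of_mul_eq hρ hk fun x y => ?_
  simp only [hentry']
  ring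

theorem finrank_ker_mulVecLin (A : QubitOp (Fin 2)) :
    A.rank + Module.finrank ℂ (LinearMap.ker A.mulVecLin) = 4 := by
  have := LinearMap.finrank_range_add_finrank_ker A.mulVecLin
  simpa [Matrix.rank] using this

/-- A two-qubit Hermitian operator of rank at least three supports a nonzero operator with vanishing
single-qubit marginals, because `3 ^ 2 > 2 * 2 ^ 2`. -/
theorem DeterminedBelow.rank_le_two {β : QubitOp (Fin 2)} (hβ : β.IsHermitian)
    (h : DeterminedBelow 2 β) : β.rank ≤ 2 := by
  by_contra hr
  obtain ⟨U, d, h1, h2, h3, h4⟩ := exists_unitary_diagonalization hβ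
  obtain ⟨e⟩ : Nonempty (Fin 3 ↪ {i // d i ≠ 0}) :=
    Function.Embedding.nonempty_of_card_le (by rw [Fintype.card_fin, ← h4]; omega)
  let s : Fin 3 → (Fin 2 → Fin 2) := fun i => (e i : Fin 2 → Fin 2)
  have hs : Function.Injective s := Subtype.val_injective.comp e.injective
  -- Three orthonormal eigenvectors with nonzero eigenvalues. Rescaling them to `W'` gives `β * W' =
  -- W`, so every `W * N * Wᴴ` is a compression by `β`.
  let W : Matrix (Fin 2 → Fin 2) (Fin 3) ℂ := U.submatrix id s
  let W' : Matrix (Fin 2 → Fin 2) (Fin 3) ℂ := W * diagonal fun i => ((d (s i) : ℂ))⁻¹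
  have hW : Wᴴ * W = 1 := by
    have : Wᴴ * W = (Uᴴ * U).submatrix s s := rfl
    rw [this, h2, submatrix_one _ hs]
  have hβU : β * U = U * diagonal fun i => (d i : ℂ) := by
    conv_lhs => rw [h3]
    rw [Matrix.mul_assoc, h2, Matrix.mul_one]
  have hβW : β * W = W * diagonal fun i => (d (s i) : ℂ) := by
    have : β * W = (β * U).submatrix id s := rfl
    rw [this, hβU]
    ext x i
    simp [W, mul_diagonal]
  have hW' : β * W' = W := by
    rw [← Matrix.mul_assoc, hβW, Matrix.mul_assoc, diagonal_mul_diagonal]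
    have : (fun i => (d (s i) : ℂ) * ((d (s i) : ℂ))⁻¹) = fun _ => 1 := by
      funext i
      exact mul_inv_cancel₀ (by exact_mod_cast (e i).2)
    rw [this, diagonal_one, Matrix.mul_one]
  have hK : ∀ N : Matrix (Fin 3) (Fin 3) ℂ, W * N * Wᴴ = β * (W' * N * W'ᴴ) * β := by
    intro N
    have : W'ᴴ * β = Wᴴ := by rw [← hW', conjTranspose_mul β W', hβ.eq]
    calc W * N * Wᴴ = (β * W') * N * (W'ᴴ * β) := by rw [hW', this]
      _ = _ := by simp only [Matrix.mul_assoc]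
  let Φ : Matrix (Fin 3) (Fin 3) ℂ →ₗ[ℂ] QubitOp (Fin 1) × QubitOp (Fin 1) :=
    { toFun := fun N =>
        (of fun x y => (W * N * Wᴴ * QubitUDA.tensor (m := 1) (n := 1) (single x y 1) 1).trace,
          of fun x y => (W * N * Wᴴ * QubitUDA.tensor (m := 1) (n := 1) 1 (single x y 1)).trace)
      map_add' := fun N N' => by
        ext <;> simp [Matrix.mul_add, Matrix.add_mul]
      map_smul' := fun c N => by
        ext <;> simp }
  -- The domain has dimension 9 and the pair of marginals only 4 + 4 = 8.
  obtain ⟨N, hN, hN0⟩ := (Submodule.ne_bot_iff _).mp (Φ.ker_ne_bot_of_finrank_lt (by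
    simp [Module.finrank_prod, Module.finrank_matrix]))
  have hN1 : ∀ x y, (W * N * Wᴴ * QubitUDA.tensor (m := 1) (n := 1) (single x y 1) 1).trace = 0 :=
    fun x y => congrFun (congrFun (congrArg Prod.fst hN) x) y
  have hN2 : ∀ x y, (W * N * Wᴴ * QubitUDA.tensor (m := 1) (n := 1) 1 (single x y 1)).trace = 0 :=
    fun x y => congrFun (congrFun (congrArg Prod.snd hN) x) y
  have f1 : traceFunctional (W * N * Wᴴ) ∘ₗ (tensorBilin 1 1).flip 1 = 0 :=
    ext_linearMap _ fun x y => LinearMap.ext_ring (hN1 x y)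
  have f2 : traceFunctional (W * N * Wᴴ) ∘ₗ tensorBilin 1 1 1 = 0 :=
    ext_linearMap _ fun x y => LinearMap.ext_ring (hN2 x y)
  rw [determinedBelow_iff hβ] at h
  have h0 := h (W' * N * W'ᴴ) (fun X hX => by
    rw [← hK]
    rw [localOp_eq_tensor (m := 1) (n := 1)]
    rw [weight_eq_add (m := 1) (n := 1)] at hX
    have one_of : ∀ Y : Fin 1 → Matrix (Fin 2) (Fin 2) ℂ, weight Y = 0 → localOp Y = 1 := by
      intro Y hY
      rw [← localOp_one]
      congr 1; funext i
      by_contra hne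
      rw [weight, Finset.sum_eq_zero_iff] at hY
      simpa [hne] using hY i (Finset.mem_univ i)
    rcases (by omega : weight (fun i : Fin 1 => X (Fin.castAdd 1 i)) = 0 ∨
      weight (fun j : Fin 1 => X (Fin.natAdd 1 j)) = 0) with h0 | h0
    · rw [one_of _ h0]
      exact congrArg (fun g => g (localOp fun j : Fin 1 => X (Fin.natAdd 1 j))) f2
    · rw [one_of _ h0]
      exact congrArg (fun g => g (localOp fun j : Fin 1 => X (Fin.castAdd 1 j))) f1)
  rw [← hK] at h0
  apply hN0
  calc N = (Wᴴ * W) * N * (Wᴴ * W) := by rw [hW]; simp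
    _ = Wᴴ * (W * N * Wᴴ) * W := by simp only [Matrix.mul_assoc]
    _ = 0 := by rw [h0]; simp

end Rank

/-! ### Product vectors in the kernel and the block normal form. -/

section TwoQubits

theorem fin_two_arrow_cases (x : Fin 2 → Fin 2) :
    x = ![0, 0] ∨ x = ![0, 1] ∨ x = ![1, 0] ∨ x = ![1, 1] := by
  revert x; decide

theorem sum_fin_two_arrow (g : (Fin 2 → Fin 2) → ℂ) :
    ∑ x, g x = g ![0, 0] + g ![0, 1] + g ![1, 0] + g ![1, 1] := by
  rw [← (finTwoArrowEquiv (Fin 2)).symm.sum_comp, Fintype.sum_prod_type]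
  simp [Fin.sum_univ_two, add_assoc]

/-- Product vectors are the zeros of the 2×2 determinant, which along `u + t • w` is a quadratic in
`t` with leading coefficient the determinant of `w`. It has a complex root, and independence of `u`
and `w` keeps the vector nonzero. -/
theorem exists_product_vector {K : Submodule ℂ ((Fin 2 → Fin 2) → ℂ)}
    (hK : 2 ≤ Module.finrank ℂ K) :
    ∃ v ∈ K, v ≠ 0 ∧ v ![0, 0] * v ![1, 1] = v ![0, 1] * v ![1, 0] := by
  obtain ⟨w, hw, hw0⟩ := (Submodule.ne_bot_iff K).mp (by
    rintro rfl; simp at hK)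
  by_cases hdet : w ![0, 0] * w ![1, 1] = w ![0, 1] * w ![1, 0]
  · exact ⟨w, hw, hw0, hdet⟩
  obtain ⟨u, hu, hus⟩ : ∃ u ∈ K, u ∉ Submodule.span ℂ {w} := by
    by_contra! h
    have := Submodule.finrank_mono (show K ≤ Submodule.span ℂ {w} from h)
    rw [finrank_span_singleton hw0] at this
    omega
  obtain ⟨t, ht⟩ := exists_quadratic_eq_zero
    (a := w ![0, 0] * w ![1, 1] - w ![0, 1] * w ![1, 0])
    (b := u ![0, 0] * w ![1, 1] + w ![0, 0] * u ![1, 1] - u ![0, 1] * w ![1, 0]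
      - w ![0, 1] * u ![1, 0])
    (c := u ![0, 0] * u ![1, 1] - u ![0, 1] * u ![1, 0])
    (sub_ne_zero.mpr hdet) (IsAlgClosed.exists_eq_mul_self _)
  refine ⟨u + t • w, K.add_mem hu (K.smul_mem t hw), fun h0 => hus ?_, ?_⟩
  · rw [eq_neg_of_add_eq_zero_left h0]
    exact Submodule.neg_mem _ (Submodule.smul_mem _ _ (Submodule.mem_span_singleton_self w))
  · simp only [Pi.add_apply, Pi.smul_apply, smul_eq_mul]
    linear_combination ht

/-- The row and the column through a nonzero entry factor a singular 2×2 array, up to that entry. -/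
theorem exists_factorization {v : (Fin 2 → Fin 2) → ℂ} (hv : v ≠ 0)
    (h : v ![0, 0] * v ![1, 1] = v ![0, 1] * v ![1, 0]) :
    ∃ a b : Fin 2 → ℂ, a ≠ 0 ∧ b ≠ 0 ∧ ∃ c : ℂ, c ≠ 0 ∧ ∀ i j, a i * b j = c * v ![i, j] := by
  obtain ⟨x, hx⟩ := Function.ne_iff.mp hv
  have hx' : v ![x 0, x 1] ≠ 0 := by
    have : ![x 0, x 1] = x := by ext i; fin_cases i <;> rfl
    rwa [this]
  refine ⟨fun i => v ![i, x 1], fun j => v ![x 0, j], fun h0 => hx' (congrFun h0 _),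
    fun h0 => hx' (congrFun h0 _), _, hx', fun i j => ?_⟩
  generalize x 0 = p at *
  generalize x 1 = q at *
  fin_cases p <;> fin_cases q <;> fin_cases i <;> fin_cases j <;>
    simp only [Fin.zero_eta, Fin.mk_one] <;> first | ring1 | linear_combination h |
      linear_combination -h

theorem exists_unitary_column {a : Fin 2 → ℂ} (ha : a ≠ 0) :
    ∃ U ∈ unitaryGroup (Fin 2) ℂ, ∃ c : ℂ, ∀ i, U i 1 = c * a i := by
  have hpos : 0 < Complex.normSq (a 0) + Complex.normSq (a 1) := by
    obtain ⟨i, hi⟩ := Function.ne_iff.mp ha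
    have h0 := Complex.normSq_nonneg (a 0)
    have h1 := Complex.normSq_nonneg (a 1)
    have h2 : 0 < Complex.normSq (a i) := Complex.normSq_pos.mpr hi
    fin_cases i
    · exact add_pos_of_pos_of_nonneg h2 h1
    · exact add_pos_of_nonneg_of_pos h0 h2
  set r := Real.sqrt (Complex.normSq (a 0) + Complex.normSq (a 1)) with hr
  have hr0 : (r : ℂ) ≠ 0 := by simpa using (Real.sqrt_pos.mpr hpos).ne'
  have hrr : (r : ℂ) * r = a 0 * star (a 0) + a 1 * star (a 1) := by
    simp only [Complex.star_def, Complex.mul_conj]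
    rw [← Complex.ofReal_mul, hr, Real.mul_self_sqrt hpos.le, Complex.ofReal_add]
  refine ⟨!![star (a 1) / r, a 0 / r; -star (a 0) / r, a 1 / r], ?_, (r : ℂ)⁻¹, fun i => ?_⟩
  · rw [mem_unitaryGroup_iff]
    simp only [Complex.star_def] at hrr ⊢
    ext i j
    fin_cases i <;> fin_cases j <;>
      simp [mul_apply, Fin.sum_univ_two, star_eq_conjTranspose] <;> field_simp <;>
      first | ring1 | linear_combination -hrr
  · fin_cases i <;> simp <;> ring

theorem posSemidef_apply_eq_zero {X : Type} [Fintype X] [DecidableEq X] {ρ : Matrix X X ℂ}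
    (hρ : ρ.PosSemidef) {j : X} (hj : ρ j j = 0) (x : X) : ρ x j = 0 ∧ ρ j x = 0 := by
  have h1 := (hρ.dotProduct_mulVec_zero_iff (Pi.single j 1)).mp (by
    simpa [← Pi.single_star] using hj)
  have h2 : ρ x j = 0 := by simpa using congrFun h1 x
  exact ⟨h2, by rw [← hρ.1.apply, h2, star_zero]⟩

/-- Up to local unitaries, a two-qubit state determined by its single-qubit marginals has `|11⟩` in
its kernel. -/
theorem exists_luEquiv_of_determinedBelow {β : QubitOp (Fin 2)} (hβ : IsState β)
    (h : DeterminedBelow 2 β) : ∃ ω : QubitOp (Fin 2), LUEquiv β ω ∧ ω ![1, 1] ![1, 1] = 0 := by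
  have hr := h.rank_le_two hβ.1.1
  obtain ⟨v, hvK, hv0, hv⟩ := exists_product_vector (K := LinearMap.ker β.mulVecLin)
    (by have := finrank_ker_mulVecLin β; omega)
  have hβv : β *ᵥ v = 0 := hvK
  obtain ⟨a, b, ha, hb, c, hc, hab⟩ := exists_factorization hv0 hv
  obtain ⟨U, hU, s, hs⟩ := exists_unitary_column ha
  obtain ⟨V, hV, t, ht⟩ := exists_unitary_column hb
  set L := localOp ![U, V] with hL
  -- The local unitary `L` sends `|11⟩` to a multiple of the kernel vector, so `Lᴴ * β * L` kills
  -- `|11⟩`.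
  have hLc : L.col ![1, 1] = (s * t * c) • v := by
    funext x
    have hx : ![x 0, x 1] = x := by ext i; fin_cases i <;> rfl
    have := hab (x 0) (x 1)
    rw [hx] at this
    simp only [hL, col_apply, localOp_apply, Fin.prod_univ_two, Pi.smul_apply, smul_eq_mul,
      cons_val_zero, cons_val_one]
    rw [hs, ht]
    linear_combination s * t * this
  have hUV : ∀ i, ![U, V] i ∈ unitaryGroup (Fin 2) ℂ := by
    intro i; fin_cases i
    · exact hU
    · exact hV
  refine ⟨Lᴴ * β * L, LUEquiv.symm ⟨fun i => (![U, V] i)ᴴ, fun i => Unitary.star_mem (hUV i), ?_⟩,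
    ?_⟩
  · rw [← localOp_conjTranspose, conjTranspose_conjTranspose]
  · have h1 : (β * L).col ![1, 1] = 0 := by
      have : (β * L).col ![1, 1] = β *ᵥ L.col ![1, 1] := rfl
      rw [this, hLc, mulVec_smul, hβv, smul_zero]
    rw [Matrix.mul_assoc, mul_apply]
    exact Finset.sum_eq_zero fun x _ => by
      rw [show (β * L) x ![1, 1] = 0 from congrFun h1 x, mul_zero]

theorem eq_blockForm {ω : QubitOp (Fin 2)} (hω : ω.PosSemidef) (h : ω ![1, 1] ![1, 1] = 0) :
    ω = blockForm (ω ![0, 0] ![0, 0]).re (ω ![0, 1] ![0, 1]).re (ω ![1, 0] ![1, 0]).re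
      (ω ![0, 1] ![1, 0]) (ω ![0, 0] ![0, 1]) (ω ![0, 0] ![1, 0]) := by
  have hd : ∀ x, ((ω x x).re : ℂ) = ω x x := fun x =>
    Complex.ext rfl (Complex.nonneg_iff.mp (hω.diag_nonneg (i := x))).2
  have hz := posSemidef_apply_eq_zero hω h
  have hh : ∀ x y, ω x y = star (ω y x) := fun x y => (hω.1.apply x y).symm
  ext x y
  rcases fin_two_arrow_cases x with rfl | rfl | rfl | rfl <;>
    rcases fin_two_arrow_cases y with rfl | rfl | rfl | rfl
  · exact (hd _).symm
  · rfl
  · rfl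
  · exact (hz _).1
  · exact hh _ _
  · exact (hd _).symm
  · rfl
  · exact (hz _).1
  · exact hh _ _
  · exact hh _ _
  · exact (hd _).symm
  · exact (hz _).1
  · exact (hz _).2
  · exact (hz _).2
  · exact (hz _).2
  · exact (hz _).2

end TwoQubits

/-! ### Two-qubit states determined by their one-qubit marginals. -/

section Classification

theorem LUEquiv.isPure {n : ℕ} {ρ σ : QubitOp (Fin n)} (h : LUEquiv ρ σ) (hσ : IsPure σ) :
    IsPure ρ := by
  obtain ⟨U, hU, rfl⟩ := h
  refine hσ.unitary_conj ?_
  rw [localOp_conjTranspose, localOp_mul, ← localOp_one]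
  congr 1; funext i
  exact mem_unitaryGroup_iff'.mp (hU i)

theorem LUEquiv.rank_eq {n : ℕ} {ρ σ : QubitOp (Fin n)} (h : LUEquiv ρ σ) : ρ.rank = σ.rank := by
  have aux : ∀ {ρ σ : QubitOp (Fin n)}, LUEquiv ρ σ → ρ.rank ≤ σ.rank := by
    rintro ρ σ ⟨U, -, rfl⟩
    exact (rank_mul_le_left _ _).trans (rank_mul_le_right _ _)
  exact le_antisymm (aux h) (aux h.symm)

theorem isPure_of_apply_one_one_eq_zero {A : Matrix (Fin 2) (Fin 2) ℂ} (hA : IsState A)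
    (h : A 1 1 = 0) : IsPure A := by
  refine isPure_of_det_eq_zero hA ?_
  rw [det_fin_two, h, (posSemidef_apply_eq_zero hA.1 h 0).1]
  simp

theorem reduced_zero_apply_one_one (ρ : QubitOp (Fin 2)) :
    reduced ρ 0 1 1 = ρ ![1, 0] ![1, 0] + ρ ![1, 1] ![1, 1] := by
  have h := trace_mul_localOp_update ρ 0 (single 1 1 1)
  rw [trace_mul_single, MulOpposite.op_one, one_smul] at h
  rw [← h]
  simp [trace, mul_apply, localOp_apply, sum_fin_two_arrow, Fin.prod_univ_two, one_apply]

theorem reduced_one_apply_one_one (ρ : QubitOp (Fin 2)) :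
    reduced ρ 1 1 1 = ρ ![0, 1] ![0, 1] + ρ ![1, 1] ![1, 1] := by
  have h := trace_mul_localOp_update ρ 1 (single 1 1 1)
  rw [trace_mul_single, MulOpposite.op_one, one_smul] at h
  rw [← h]
  simp [trace, mul_apply, localOp_apply, sum_fin_two_arrow, Fin.prod_univ_two, one_apply]

/-- A state on the span of `|01⟩` and `|10⟩` that is determined by its single-qubit marginals is
pure. -/
theorem isPure_of_antiparallel {ω : QubitOp (Fin 2)} (hω : IsState ω) (h : DeterminedBelow 2 ω)
    (h0 : ω ![0, 0] ![0, 0] = 0) (h1 : ω ![1, 1] ![1, 1] = 0) : IsPure ω := by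
  let e : Fin 2 → (Fin 2 → Fin 2) := ![![0, 1], ![1, 0]]
  let D := ω.submatrix e e
  let E : Matrix (Fin 2 → Fin 2) (Fin 2) ℂ := of fun x i => if x = e i then 1 else 0
  have hE : ∀ Y : QubitOp (Fin 2), Eᴴ * Y * E = Y.submatrix e e := by
    intro Y
    ext i j
    simp [E, mul_apply]
  have hEE : Eᴴ * E = 1 := by
    rw [← Matrix.mul_one Eᴴ, hE]
    exact submatrix_one e (by decide)
  have hz0 := posSemidef_apply_eq_zero hω.1 h0
  have hz1 := posSemidef_apply_eq_zero hω.1 h1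
  have d : ∀ i j, D i j = ω (e i) (e j) := fun _ _ => rfl
  have hωD : ω = E * D * Eᴴ := by
    ext x y
    rcases fin_two_arrow_cases x with rfl | rfl | rfl | rfl <;>
      rcases fin_two_arrow_cases y with rfl | rfl | rfl | rfl <;>
      simp [E, d, e, mul_apply, Fin.sum_univ_two, hz0, hz1]
  have hD : IsState D := by
    refine ⟨hω.1.submatrix e, ?_⟩
    have := hω.2
    rw [hωD, Matrix.mul_assoc, trace_mul_comm, Matrix.mul_assoc, hEE, Matrix.mul_one] at this
    exact this
  by_cases hdet : D.det = 0
  · obtain ⟨ψ, hψ, hDψ⟩ := isPure_of_det_eq_zero hD hdet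
    rw [hωD, hDψ]
    refine ⟨E *ᵥ ψ, ?_, ?_⟩
    · rw [star_mulVec, ← dotProduct_mulVec, mulVec_mulVec, hEE, one_mulVec, hψ]
    · rw [mul_vecMulVec, vecMulVec_mul, star_mulVec]
  · exfalso
    have hu : IsUnit D.det := Ne.isUnit hdet
    -- For invertible `D` this entry depends only on the compression. It vanishes on operators of
    -- weight at most one because `|01⟩` and `|10⟩` differ in both qubits, so it contradicts
    -- determination.
    have hf := h (entryLinearMap ℂ ℂ ![0, 1] ![1, 0]) (fun Y hY => by
      have e1 : D * Y.submatrix e e * D = 0 := by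
        rw [← hE]
        calc D * (Eᴴ * Y * E) * D = (Eᴴ * E) * D * (Eᴴ * Y * E) * D * (Eᴴ * E) := by
              rw [hEE]; simp
          _ = Eᴴ * ((E * D * Eᴴ) * Y * (E * D * Eᴴ)) * E := by simp only [Matrix.mul_assoc]
          _ = 0 := by rw [← hωD, hY]; simp
      have e2 : Y.submatrix e e = 0 := by
        calc Y.submatrix e e = (D⁻¹ * D) * Y.submatrix e e * (D * D⁻¹) := by
              rw [nonsing_inv_mul _ hu, mul_nonsing_inv _ hu]; simp
          _ = D⁻¹ * (D * Y.submatrix e e * D) * D⁻¹ := by simp only [Matrix.mul_assoc]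
          _ = 0 := by rw [e1]; simp
      exact congrFun (congrFun e2 0) 1)
      (fun X hX => by
        have : X 0 = 1 ∨ X 1 = 1 := by
          by_contra! hne
          simp [weight, Fin.sum_univ_two, hne] at hX
        simp only [entryLinearMap_apply, localOp_apply, Fin.prod_univ_two, cons_val_zero,
          cons_val_one]
        rcases this with h | h <;> simp [h])
    have := congrArg (fun g => g (single ![0, 1] ![1, 0] 1)) hf
    simp at this

/-- Once `|11⟩` is in the kernel, a vanishing diagonal entry makes the state or a marginal pure:
`00` leaves the antiparallel case, `10` and `01` make the first and second marginal pure. Otherwise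
rank two gives a block state. -/
theorem DeterminedBelow.classification {β : QubitOp (Fin 2)} (hβ : IsState β)
    (h : DeterminedBelow 2 β) :
    IsPure β ∨ IsPure (reduced β 0) ∨ IsPure (reduced β 1) ∨
      ∃ ω, IsBlockState ω ∧ LUEquiv β ω := by
  obtain ⟨ω, hLU, h11⟩ := exists_luEquiv_of_determinedBelow hβ h
  have hω := hLU.symm.isState hβ
  have hωd := hLU.symm.determinedBelow h
  rcases isPure_or_two_le_rank hω with hp | hr
  · exact .inl (hLU.isPure hp)
  by_cases h00 : ω ![0, 0] ![0, 0] = 0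
  · exact .inl (hLU.isPure (isPure_of_antiparallel hω hωd h00 h11))
  by_cases h10 : ω ![1, 0] ![1, 0] = 0
  · refine .inr (.inl (hLU.isPure_reduced (isPure_of_apply_one_one_eq_zero (hω.reduced 0) ?_)))
    rw [reduced_zero_apply_one_one, h10, h11, add_zero]
  by_cases h01 : ω ![0, 1] ![0, 1] = 0
  · refine .inr (.inr (.inl
      (hLU.isPure_reduced (isPure_of_apply_one_one_eq_zero (hω.reduced 1) ?_))))
    rw [reduced_one_apply_one_one, h01, h11, add_zero]
  refine .inr (.inr (.inr ⟨ω, ⟨hω, le_antisymm (hωd.rank_le_two hω.1.1) hr,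
    _, _, _, _, _, _, ?_, eq_blockForm hω.1 h11⟩, hLU⟩))
  have hpos : ∀ {x}, ω x x ≠ 0 → 0 < (ω x x).re := fun {x} hx =>
    (Complex.pos_iff.mp (lt_of_le_of_ne hω.1.diag_nonneg (Ne.symm hx))).1
  exact mul_pos (mul_pos (hpos h00) (hpos h01)) (hpos h10)

/-- A compression `K` with zero marginals vanishes on the row and column of `11`, and the marginal
equations then leave only the entries coupling `01` and `10`. Rank two supplies a second kernel
vector `v`, and `K *ᵥ v = 0` with its adjoint version removes these. -/
theorem IsBlockState.determinedBelow {ω : QubitOp (Fin 2)} (h : IsBlockState ω) :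
    DeterminedBelow 2 ω := by
  obtain ⟨hω, hr, q₁, q₂, q₃, x, y, z, hq, hωb⟩ := h
  have hc : ∀ s, ω s ![1, 1] = 0 := fun s =>
    (posSemidef_apply_eq_zero hω.1 (by rw [hωb]; rfl) s).1
  -- a kernel vector independent of `|11⟩`
  obtain ⟨⟨v, hvk⟩, hv1, hv0⟩ := (Submodule.ne_bot_iff _).mp
    (((LinearMap.proj (R := ℂ) (φ := fun _ => ℂ) ![1, 1]) ∘ₗ
      (LinearMap.ker ω.mulVecLin).subtype).ker_ne_bot_of_finrank_lt (by
        have := finrank_ker_mulVecLin ω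
        rw [Module.finrank_self]; omega))
  have hv11 : v ![1, 1] = 0 := hv1
  have hωv : ω *ᵥ v = 0 := hvk
  have hvne : v ≠ 0 := fun h0 => hv0 (Subtype.ext h0)
  -- Otherwise `v` is a multiple of `|00⟩`, which `q₁ ≠ 0` keeps out of the kernel.
  have hv : v ![0, 1] ≠ 0 ∨ v ![1, 0] ≠ 0 := by
    by_contra! hcon
    have h1 := congrFun hωv ![0, 0]
    simp only [mulVec, dotProduct, sum_fin_two_arrow, hcon, hv11, mul_zero, add_zero,
      Pi.zero_apply] at h1
    have hq1 : ω ![0, 0] ![0, 0] = q₁ := by rw [hωb]; rfl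
    have hq0 : (q₁ : ℂ) ≠ 0 := by
      intro h0
      rw [Complex.ofReal_eq_zero] at h0
      simp [h0] at hq
    rw [hq1] at h1
    have h00 := (mul_eq_zero.mp h1).resolve_left hq0
    apply hvne
    funext s
    rcases fin_two_arrow_cases s with rfl | rfl | rfl | rfl
    · exact h00
    · exact hcon.1
    · exact hcon.2
    · exact hv11
  rw [determinedBelow_iff hω.1.1]
  intro M hM
  set K := ω * M * ω with hK
  have hKr : ∀ s, K s ![1, 1] = 0 := fun s => by
    rw [hK, mul_apply]; exact Finset.sum_eq_zero fun t _ => by rw [hc, mul_zero]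
  have hKl : ∀ s, K ![1, 1] s = 0 := fun s => by
    rw [hK, Matrix.mul_assoc, mul_apply]
    exact Finset.sum_eq_zero fun t _ => by
      rw [← hω.1.1.apply, hc, star_zero, zero_mul]
  have hKv : K *ᵥ v = 0 := by rw [hK, ← mulVec_mulVec, hωv, mulVec_zero]
  have hvK : star v ᵥ* K = 0 := by
    have : star v ᵥ* ω = 0 := by
      rw [← hω.1.1.eq, ← star_mulVec, hωv, star_zero]
    rw [hK, Matrix.mul_assoc, ← vecMul_vecMul, this, zero_vecMul]
  have m0 : ∀ i j, K ![j, 0] ![i, 0] + K ![j, 1] ![i, 1] = 0 := fun i j => by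
    have := hM ![single i j 1, 1] (Nat.lt_succ_of_le (weight_le_card (S := {0})
      fun i hi => by fin_cases i <;> simp_all))
    rw [← this]
    fin_cases i <;> fin_cases j <;>
      simp [trace, mul_apply, localOp_apply, sum_fin_two_arrow, Fin.prod_univ_two, one_apply]
  have m1 : ∀ i j, K ![0, j] ![0, i] + K ![1, j] ![1, i] = 0 := fun i j => by
    have := hM ![1, single i j 1] (Nat.lt_succ_of_le (weight_le_card (S := {1})
      fun i hi => by fin_cases i <;> simp_all))
    rw [← this]
    fin_cases i <;> fin_cases j <;>
      simp [trace, mul_apply, localOp_apply, sum_fin_two_arrow, Fin.prod_univ_two, one_apply]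
  have k1 : K ![1, 0] ![1, 0] = 0 := by simpa [hKr] using m0 1 1
  have k2 : K ![0, 1] ![0, 1] = 0 := by simpa [hKr] using m1 1 1
  have k3 : K ![0, 0] ![0, 0] = 0 := by simpa [k2] using m0 0 0
  have k4 : K ![0, 0] ![1, 0] = 0 := by simpa [hKr] using m0 1 0
  have k5 : K ![1, 0] ![0, 0] = 0 := by simpa [hKl] using m0 0 1
  have k6 : K ![0, 0] ![0, 1] = 0 := by simpa [hKr] using m1 1 0
  have k7 : K ![0, 1] ![0, 0] = 0 := by simpa [hKl] using m1 0 1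
  have e1 : K ![0, 1] ![1, 0] * v ![1, 0] = 0 := by
    simpa [mulVec, dotProduct, sum_fin_two_arrow, k7, k2, hv11] using congrFun hKv ![0, 1]
  have e2 : K ![1, 0] ![0, 1] * v ![0, 1] = 0 := by
    simpa [mulVec, dotProduct, sum_fin_two_arrow, k1, k5, hv11] using congrFun hKv ![1, 0]
  have e3 : star (v ![0, 1]) * K ![0, 1] ![1, 0] = 0 := by
    simpa [vecMul, dotProduct, sum_fin_two_arrow, k1, k4, hv11] using congrFun hvK ![1, 0]
  have e4 : star (v ![1, 0]) * K ![1, 0] ![0, 1] = 0 := by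
    simpa [vecMul, dotProduct, sum_fin_two_arrow, k2, k6, hv11] using congrFun hvK ![0, 1]
  have k8 : K ![0, 1] ![1, 0] = 0 ∧ K ![1, 0] ![0, 1] = 0 := by
    rcases hv with hv | hv
    · exact ⟨(mul_eq_zero.mp e3).resolve_left (star_ne_zero.mpr hv),
        (mul_eq_zero.mp e2).resolve_right hv⟩
    · exact ⟨(mul_eq_zero.mp e1).resolve_right hv,
        (mul_eq_zero.mp e4).resolve_left (star_ne_zero.mpr hv)⟩
  ext s t
  rcases fin_two_arrow_cases s with rfl | rfl | rfl | rfl <;>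
    rcases fin_two_arrow_cases t with rfl | rfl | rfl | rfl <;>
    simp only [hKr, hKl, k1, k2, k3, k4, k5, k6, k7, k8.1, k8.2, Matrix.zero_apply]

theorem determinedBelow_two_iff {β : QubitOp (Fin 2)} (hβ : IsState β) :
    DeterminedBelow 2 β ↔ IsPure β ∨ IsPure (reduced β 0) ∨ IsPure (reduced β 1) ∨
      ∃ ω, IsBlockState ω ∧ LUEquiv β ω := by
  refine ⟨fun h => h.classification hβ, ?_⟩
  rintro (h | h | h | ⟨ω, hω, h⟩)
  · exact h.determinedBelow.mono one_le_two
  · obtain ⟨φ, τ, hφ, -, rfl⟩ := exists_product_of_isPure_reduced_zero hβ h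
    exact determinedBelow_two_product11_left hφ
  · obtain ⟨φ, τ, hφ, -, rfl⟩ := exists_product_of_isPure_reduced_one hβ h
    exact determinedBelow_two_product11_right hφ
  · exact h.determinedBelow hω.determinedBelow

end Classification

/-! ### Combining the three factors. -/

section Assembly

variable {α : QubitOp (Fin 1)} {β γ : QubitOp (Fin 2)}

theorem isUDA_product122_iff (hα : IsState α) (hβ : IsState β) (hγ : IsState γ) :
    IsUDA 2 (product122 α β γ) ↔ DeterminedBelow 3 (product122 α β γ) :=
  ⟨fun h => h.determinedBelow (by norm_num), fun h =>
    isUDA_of_determinedBelow hα hβ hγ one_le_two le_rfl le_rfl (by norm_num) h⟩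

theorem determinedBelow_product122_of {α : QubitOp (Fin 1)} {β γ : QubitOp (Fin 2)} {i j k : ℕ}
    (hα : DeterminedBelow (i + 1) α) (hβ : DeterminedBelow (j + 1) β)
    (hγ : DeterminedBelow (k + 1) γ) (h : i + j + k ≤ 2) :
    DeterminedBelow 3 (product122 α β γ) :=
  DeterminedBelow.mono ((hα.tensor hβ).tensor hγ) (by omega)

theorem not_determinedBelow_product122 (hα : IsState α) (hβ : IsState β) (hγ : IsState γ)
    {i j k : ℕ} (h : i + j + k = 3) (h1 : ¬ DeterminedBelow i α) (h2 : ¬ DeterminedBelow j β)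
    (h3 : ¬ DeterminedBelow k γ) : ¬ DeterminedBelow 3 (product122 α β γ) := by
  rw [← h]
  exact not_determinedBelow_tensor (hα.tensor hβ).1.1 hγ.1.1
    (not_determinedBelow_tensor hα.1.1 hβ.1.1 h1 h2) h3

theorem determinedBelow_one_iff {n : ℕ} {ρ : QubitOp (Fin n)} (hρ : IsState ρ) :
    DeterminedBelow 1 ρ ↔ IsPure ρ :=
  ⟨fun h => h.isPure hρ, fun h => h.determinedBelow⟩

/-- The right side lists the ways in which three values of `d`, at most 1, 2 and 2, can sum to at
most 2. -/
theorem isUDA_product122_iff_purity (hα : IsState α) (hβ : IsState β) (hγ : IsState γ) :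
    IsUDA 2 (product122 α β γ) ↔
      (IsPure β ∧ (IsPure α ∨ DeterminedBelow 2 γ)) ∨
      (IsPure γ ∧ (IsPure α ∨ DeterminedBelow 2 β)) ∨
      (IsPure α ∧ DeterminedBelow 2 β ∧ DeterminedBelow 2 γ) := by
  rw [isUDA_product122_iff hα hβ hγ]
  constructor
  · intro h
    -- Undetermined factors at `i`, `j`, `k` would tensor to an undetermined state at 3. A slot
    -- equal to 0 is never determined, so it drops out of the alternatives.
    have key : ∀ i j k, i + j + k = 3 →
        DeterminedBelow i α ∨ DeterminedBelow j β ∨ DeterminedBelow k γ := by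
      intro i j k hs
      by_contra! hc
      exact not_determinedBelow_product122 hα hβ hγ hs hc.1 hc.2.1 hc.2.2 h
    have h111 := key 1 1 1 rfl
    have h120 : DeterminedBelow 1 α ∨ DeterminedBelow 2 β :=
      (key 1 2 0 rfl).imp_right fun h => h.resolve_right (not_determinedBelow_zero hγ)
    have h102 : DeterminedBelow 1 α ∨ DeterminedBelow 2 γ :=
      (key 1 0 2 rfl).imp_right fun h => h.resolve_left (not_determinedBelow_zero hβ)
    have h012 := (key 0 1 2 rfl).resolve_left (not_determinedBelow_zero hα)
    have h021 := (key 0 2 1 rfl).resolve_left (not_determinedBelow_zero hα)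
    rw [determinedBelow_one_iff hα, determinedBelow_one_iff hβ, determinedBelow_one_iff hγ] at h111
    rw [determinedBelow_one_iff hα] at h120 h102
    rw [determinedBelow_one_iff hβ] at h012
    rw [determinedBelow_one_iff hγ] at h021
    clear key h
    generalize DeterminedBelow 2 β = b at *
    generalize DeterminedBelow 2 γ = c at *
    tauto
  · have hα2 : DeterminedBelow 2 α := determinedBelow_of_lt α one_lt_two
    have hβ3 : DeterminedBelow 3 β := determinedBelow_of_lt β (by norm_num)
    have hγ3 : DeterminedBelow 3 γ := determinedBelow_of_lt γ (by norm_num)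
    rintro (⟨hb, ha | hc⟩ | ⟨hc, ha | hb⟩ | ⟨ha, hb, hc⟩)
    · exact determinedBelow_product122_of (i := 0) (j := 0) (k := 2)
        ha.determinedBelow hb.determinedBelow hγ3 (by norm_num)
    · exact determinedBelow_product122_of (i := 1) (j := 0) (k := 1)
        hα2 hb.determinedBelow hc (by norm_num)
    · exact determinedBelow_product122_of (i := 0) (j := 2) (k := 0)
        ha.determinedBelow hβ3 hc.determinedBelow (by norm_num)
    · exact determinedBelow_product122_of (i := 1) (j := 1) (k := 0)
        hα2 hb hc.determinedBelow (by norm_num)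
    · exact determinedBelow_product122_of (i := 0) (j := 1) (k := 1)
        ha.determinedBelow hb hc (by norm_num)

theorem threeQubitConditions_iff (hα : IsState α) (hβ : IsState β) :
    ThreeQubitConditions α β ↔ IsPure α ∨ DeterminedBelow 2 β := by
  have r0 : IsPure (marginal (product12 α β) {0}) ↔ IsPure α := by
    rw [isPure_marginal_singleton, ← isPure_reduced_oneQubit α]
    exact iff_of_eq (congrArg IsPure (reduced_tensor_castAdd α hβ.2 0))
  have r1 : IsPure (marginal (product12 α β) {1}) ↔ IsPure (reduced β 0) := by
    rw [isPure_marginal_singleton]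
    exact iff_of_eq (congrArg IsPure (reduced_tensor_natAdd hα.2 β 0))
  have r2 : IsPure (marginal (product12 α β) {2}) ↔ IsPure (reduced β 1) := by
    rw [isPure_marginal_singleton]
    exact iff_of_eq (congrArg IsPure (reduced_tensor_natAdd hα.2 β 1))
  rw [ThreeQubitConditions, determinedBelow_two_iff hβ, Fin.exists_fin_succ, Fin.exists_fin_two]
  change (IsPure (marginal (product12 α β) {0}) ∨ IsPure (marginal (product12 α β) {1}) ∨
    IsPure (marginal (product12 α β) {2})) ∨ _ ↔ _
  rw [r0, r1, r2]
  constructor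
  · rintro ((h | h | h) | h | ⟨-, -, h⟩) <;> tauto
  · rintro (h | h | h | h | ⟨ω, hω, h⟩)
    · tauto
    · tauto
    · tauto
    · tauto
    · rcases isPure_or_rank_eq_two hα with hp | hr
      · tauto
      · exact .inr (.inr ⟨hr, h.rank_eq.trans hω.2.1, ω, hω, h⟩)

/-- A product of two pure states is pure, so in a non-pure `β` the factor beside the pure one has
rank two. -/
theorem exists_rank_two_product (hβ : IsState β) (hp : ¬ IsPure β)
    (h : IsPure (reduced β 0) ∨ IsPure (reduced β 1)) :
    ∃ φ τ : QubitOp (Fin 1), IsPure φ ∧ IsState τ ∧ τ.rank = 2 ∧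
      (β = product11 φ τ ∨ β = product11 τ φ) := by
  have pure_product : ∀ φ τ : QubitOp (Fin 1), IsPure φ → IsPure τ → IsPure (product11 φ τ) :=
    fun φ τ h1 h2 => DeterminedBelow.isPure (h1.isState.tensor h2.isState)
      (DeterminedBelow.tensor (j := 0) (k := 0) h1.determinedBelow h2.determinedBelow)
  rcases h with h | h
  · obtain ⟨φ, τ, hφ, hτ, rfl⟩ := exists_product_of_isPure_reduced_zero hβ h
    exact ⟨φ, τ, hφ, hτ, (isPure_or_rank_eq_two hτ).resolve_left
      fun hτ' => hp (pure_product _ _ hφ hτ'), .inl rfl⟩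
  · obtain ⟨φ, τ, hφ, hτ, rfl⟩ := exists_product_of_isPure_reduced_one hβ h
    exact ⟨φ, τ, hφ, hτ, (isPure_or_rank_eq_two hτ).resolve_left
      fun hτ' => hp (pure_product _ _ hτ' hφ), .inr rfl⟩

theorem LUEquiv.product122 {β' γ' : QubitOp (Fin 2)} (hβ : LUEquiv β β') (hγ : LUEquiv γ γ') :
    LUEquiv (product122 α β γ) (product122 α β' γ') :=
  ((LUEquiv.refl α).tensor hβ).tensor hγ

end Assembly

end QubitUDA

end

/-! ### The classification theorem. -/

open QubitUDA in
theorem mainTheorem5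
    (ρA1 : QubitUDA.QubitOp (Fin 1)) (ρA2A3 ρA4A5 : QubitUDA.QubitOp (Fin 2))
    (h1 : QubitUDA.IsState ρA1) (h23 : QubitUDA.IsState ρA2A3)
    (h45 : QubitUDA.IsState ρA4A5) :
    QubitUDA.IsUDA 2 (QubitUDA.product122 ρA1 ρA2A3 ρA4A5) ↔
      -- (i)
      ((QubitUDA.IsPure ρA2A3 ∧ QubitUDA.ThreeQubitConditions ρA1 ρA4A5) ∨
        (QubitUDA.IsPure ρA4A5 ∧ QubitUDA.ThreeQubitConditions ρA1 ρA2A3)) ∨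
      -- (ii)
      (QubitUDA.IsPure ρA1 ∧
        (QubitUDA.IsPure (QubitUDA.marginal (QubitUDA.product122 ρA1 ρA2A3 ρA4A5) {1}) ∨
          QubitUDA.IsPure (QubitUDA.marginal (QubitUDA.product122 ρA1 ρA2A3 ρA4A5) {2})) ∧
        (QubitUDA.IsPure (QubitUDA.marginal (QubitUDA.product122 ρA1 ρA2A3 ρA4A5) {3}) ∨
          QubitUDA.IsPure (QubitUDA.marginal (QubitUDA.product122 ρA1 ρA2A3 ρA4A5) {4}))) ∨
      -- (iii)
      (∃ (ψ φ τ : QubitUDA.QubitOp (Fin 1)) (ω : QubitUDA.QubitOp (Fin 2)),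
        QubitUDA.IsPure ψ ∧ QubitUDA.IsPure φ ∧
        QubitUDA.IsState τ ∧ τ.rank = 2 ∧ QubitUDA.IsBlockState ω ∧
        (QubitUDA.LUEquiv (QubitUDA.product122 ρA1 ρA2A3 ρA4A5)
            (QubitUDA.product122 ψ (QubitUDA.product11 φ τ) ω) ∨
          QubitUDA.LUEquiv (QubitUDA.product122 ρA1 ρA2A3 ρA4A5)
            (QubitUDA.product122 ψ (QubitUDA.product11 τ φ) ω) ∨
          QubitUDA.LUEquiv (QubitUDA.product122 ρA1 ρA2A3 ρA4A5)
            (QubitUDA.product122 ψ ω (QubitUDA.product11 φ τ)) ∨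
          QubitUDA.LUEquiv (QubitUDA.product122 ρA1 ρA2A3 ρA4A5)
            (QubitUDA.product122 ψ ω (QubitUDA.product11 τ φ)))) ∨
      -- (iv)
      (∃ (ψ : QubitUDA.QubitOp (Fin 1)) (η ω : QubitUDA.QubitOp (Fin 2)),
        QubitUDA.IsPure ψ ∧ QubitUDA.IsBlockState η ∧ QubitUDA.IsBlockState ω ∧
        QubitUDA.LUEquiv (QubitUDA.product122 ρA1 ρA2A3 ρA4A5)
          (QubitUDA.product122 ψ η ω)) := by
  have hβγ : IsState (tensor ρA1 ρA2A3) := h1.tensor h23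
  have r1 : IsPure (marginal (product122 ρA1 ρA2A3 ρA4A5) {1}) ↔ IsPure (reduced ρA2A3 0) := by
    rw [isPure_marginal_singleton]
    exact iff_of_eq (congrArg IsPure ((reduced_tensor_castAdd _ h45.2 (Fin.natAdd 1 0)).trans
      (reduced_tensor_natAdd h1.2 ρA2A3 0)))
  have r2 : IsPure (marginal (product122 ρA1 ρA2A3 ρA4A5) {2}) ↔ IsPure (reduced ρA2A3 1) := by
    rw [isPure_marginal_singleton]
    exact iff_of_eq (congrArg IsPure ((reduced_tensor_castAdd _ h45.2 (Fin.natAdd 1 1)).trans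
      (reduced_tensor_natAdd h1.2 ρA2A3 1)))
  have r3 : IsPure (marginal (product122 ρA1 ρA2A3 ρA4A5) {3}) ↔ IsPure (reduced ρA4A5 0) := by
    rw [isPure_marginal_singleton]
    exact iff_of_eq (congrArg IsPure (reduced_tensor_natAdd hβγ.2 ρA4A5 0))
  have r4 : IsPure (marginal (product122 ρA1 ρA2A3 ρA4A5) {4}) ↔ IsPure (reduced ρA4A5 1) := by
    rw [isPure_marginal_singleton]
    exact iff_of_eq (congrArg IsPure (reduced_tensor_natAdd hβγ.2 ρA4A5 1))
  rw [r1, r2, r3, r4, threeQubitConditions_iff h1 h45, threeQubitConditions_iff h1 h23]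
  constructor
  · rw [isUDA_product122_iff_purity h1 h23 h45]
    rintro (h | h | ⟨ha, hb, hc⟩)
    · exact .inl (.inl h)
    · exact .inl (.inr h)
    -- With `ρA1` pure, a pure pair already gives the first condition. For two non-pure pairs, each
    -- has a pure marginal or a block form, and the four combinations give the other three
    -- conditions.
    by_cases pb : IsPure ρA2A3
    · exact .inl (.inl ⟨pb, .inl ha⟩)
    by_cases pc : IsPure ρA4A5
    · exact .inl (.inr ⟨pc, .inl ha⟩)
    have hb' : (IsPure (reduced ρA2A3 0) ∨ IsPure (reduced ρA2A3 1)) ∨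
        ∃ ω, IsBlockState ω ∧ LUEquiv ρA2A3 ω :=
      or_assoc.mpr (((determinedBelow_two_iff h23).mp hb).resolve_left pb)
    have hc' : (IsPure (reduced ρA4A5 0) ∨ IsPure (reduced ρA4A5 1)) ∨
        ∃ ω, IsBlockState ω ∧ LUEquiv ρA4A5 ω :=
      or_assoc.mpr (((determinedBelow_two_iff h45).mp hc).resolve_left pc)
    rcases hb' with mb | ⟨η, hη, hbη⟩ <;> rcases hc' with mc | ⟨ω, hω, hcω⟩
    · exact .inr (.inl ⟨ha, mb, mc⟩)
    · obtain ⟨φ, τ, hφ, hτ, hr, e⟩ := exists_rank_two_product h23 pb mb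
      refine .inr (.inr (.inl ⟨ρA1, φ, τ, ω, ha, hφ, hτ, hr, hω, ?_⟩))
      rcases e with rfl | rfl
      · exact .inl ((LUEquiv.refl _).product122 hcω)
      · exact .inr (.inl ((LUEquiv.refl _).product122 hcω))
    · obtain ⟨φ, τ, hφ, hτ, hr, e⟩ := exists_rank_two_product h45 pc mc
      refine .inr (.inr (.inl ⟨ρA1, φ, τ, η, ha, hφ, hτ, hr, hη, ?_⟩))
      rcases e with rfl | rfl
      · exact .inr (.inr (.inl (hbη.product122 (LUEquiv.refl _))))
      · exact .inr (.inr (.inr (hbη.product122 (LUEquiv.refl _))))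
    · exact .inr (.inr (.inr ⟨ρA1, η, ω, ha, hη, hω, hbη.product122 hcω⟩))
  -- Determination is transported along LU equivalence, so only the normal form is examined.
  · have of_lu : ∀ ψ η ω, LUEquiv (product122 ρA1 ρA2A3 ρA4A5) (product122 ψ η ω) → IsPure ψ →
        DeterminedBelow 2 η → DeterminedBelow 2 ω → IsUDA 2 (product122 ρA1 ρA2A3 ρA4A5) := by
      intro ψ η ω h hψ hη hω
      exact (isUDA_product122_iff h1 h23 h45).mpr (h.determinedBelow
        (determinedBelow_product122_of (i := 0) (j := 1) (k := 1) hψ.determinedBelow hη hω le_rfl))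
    rintro ((h | h) | ⟨ha, mb, mc⟩ | ⟨ψ, φ, τ, ω, hψ, hφ, -, -, hω, h⟩ | ⟨ψ, η, ω, hψ, hη, hω, h⟩)
    · exact (isUDA_product122_iff_purity h1 h23 h45).mpr (.inl h)
    · exact (isUDA_product122_iff_purity h1 h23 h45).mpr (.inr (.inl h))
    · refine (isUDA_product122_iff_purity h1 h23 h45).mpr (.inr (.inr ⟨ha, ?_, ?_⟩))
      · exact (determinedBelow_two_iff h23).mpr (.inr (mb.imp_right .inl))
      · exact (determinedBelow_two_iff h45).mpr (.inr (mc.imp_right .inl))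
    · have hl := determinedBelow_two_product11_left (τ := τ) hφ
      have hr := determinedBelow_two_product11_right (τ := τ) hφ
      have hd := hω.determinedBelow
      rcases h with h | h | h | h
      · exact of_lu _ _ _ h hψ hl hd
      · exact of_lu _ _ _ h hψ hr hd
      · exact of_lu _ _ _ h hψ hd hl
      · exact of_lu _ _ _ h hψ hd hr
    · exact of_lu _ _ _ h hψ hη.determinedBelow hω.determinedBelow
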